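/- Let $2P_4$ be the disjoint union of two paths on four vertices each. For a graph $G$, let $ar(K_n,G)$ denote the maximum number of colors in an edge-coloring of the complete graph $K_n$ that contains no rainbow copy of $G$, i.e. no (not necessarily induced) subgraph isomorphic to $G$ all of whose edges have different colors. Then for every integer $n\ge 8$, $$ar(K_n,2P_4)=\max\{2n-2,\,16\}.$$ -/

import Mathlib

open SimpleGraph

namespace AntiRamsey

/-- The edge-colouring `c` of the complete graph on `V` contains a rainbow copy of `G`: a (not
necessarily induced) subgraph isomorphic to `G`, all of whose edges have different colours. -/
def HasRainbowCopy {V W K : Type*} (G : SimpleGraph W) (c : TopEdgeLabeling V K) : Prop :=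
  ∃ f : Copy G (⊤ : SimpleGraph V), Function.Injective fun e : G.edgeSet => c (f.mapEdgeSet e)

/-- The set of all `k` such that some edge-colouring of `K_n` uses exactly `k` colours and has no
rainbow copy of `G`. -/
def colorCounts {W : Type*} (n : ℕ) (G : SimpleGraph W) : Set ℕ :=
  {k | ∃ c : TopEdgeLabeling (Fin n) (Fin k), Function.Surjective c ∧ ¬ HasRainbowCopy G c}

/-- A colouring of `K_n` uses at most `n.choose 2` colours, so the supremum below is a maximum
as soon as `colorCounts n G` is nonempty. -/
theorem bddAbove_colorCounts {W : Type*} (n : ℕ) (G : SimpleGraph W) :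
    BddAbove (colorCounts n G) := by
  refine ⟨n.choose 2, ?_⟩
  rintro k ⟨c, hc, -⟩
  have h := Fintype.card_le_of_surjective (α := (⊤ : SimpleGraph (Fin n)).edgeSet) c hc
  rw [← edgeFinset_card, card_edgeFinset_top_eq_card_choose_two] at h
  simpa using h

/-- The anti-Ramsey number `ar(K_n, G)`: the maximum number of colours in an edge-colouring of
`K_n` with no rainbow copy of `G`. -/
noncomputable def antiRamseyNumber {W : Type*} (n : ℕ) (G : SimpleGraph W) : ℕ :=
  sSup (colorCounts n G)

/-- `2P₄`, the disjoint union of two paths on four vertices each. -/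
def twoP4 : SimpleGraph (Fin 4 ⊕ Fin 4) := pathGraph 4 ⊕g pathGraph 4

end AntiRamsey

namespace AntiRamsey

/-! Lower bound: give the edges of a `K₆`, or the edges meeting two fixed vertices, pairwise
different colours, and give all other edges one further colour. This uses 16, respectively `2n - 2`,
colours. Eight vertices leave at least two outside the `K₆`, and any two vertices of `2P₄` meet at
least two of its edges and miss at least two, so every copy of `2P₄` repeats the common colour.

Upper bound: choose one edge of each colour, which gives a graph `G` with as many edges as there are
colours. A `2P₄` in `G` is rainbow, but many edges alone do not force one: three vertices joined to
each other and to everything else give `3n - 6` edges, and no `2P₄`, whose edges cannot be covered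
by three vertices. Hence `IsRobust`: if a non-edge `uv` of `G` has the colour of the representative
`ab`, then `G + uv - ab` is again rainbow, and it contains `2P₄` whichever edge `ab` is
(`hasRainbowCopy_of_isRobust`).

It remains to show that more than `max (2n - 2) 16` edges make a graph robust
(`isRobust_of_card_edgeFinset`). For `n = 8, 9` a finite search extends a path vertex by vertex
until it contains `2P₄`, unless the graph is found to be robust on the way. From `n = 10` on, a
vertex of degree at most two can be deleted, since the bound grows by two. If all degrees are at
least three and there is no `2P₄`, rotating longest paths gives a path on seven vertices
(`hasPath_seven`). The edge count then forces every vertex outside it to be joined exactly to its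
second, fourth and sixth vertices (`IsSevenPath.adj_outside_iff`). Exchanging vertices reveals a
`K_{3,n-3}`, and one edge added inside its large side lies in two copies of `2P₄` that share only
that edge. -/

/-- The relation `R` contains two vertex-disjoint paths on four vertices each. -/
def HasTwoP4 {V : Type*} (R : V → V → Prop) : Prop :=
  ∃ a b c d e f g h : V, [a, b, c, d, e, f, g, h].Nodup ∧
    R a b ∧ R b c ∧ R c d ∧ R e f ∧ R f g ∧ R g h

/-- Either `G` contains `2P₄`, or some non-edge `uv` is such that `G + uv - ab` contains `2P₄` for
every edge `ab` of `G`. -/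
def IsRobust {V : Type*} (G : SimpleGraph V) : Prop :=
  HasTwoP4 G.Adj ∨ ∃ u v, u ≠ v ∧ ¬ G.Adj u v ∧ ∀ a b, G.Adj a b →
    HasTwoP4 fun x y => (G.Adj x y ∨ s(x, y) = s(u, v)) ∧ s(x, y) ≠ s(a, b)

/-- `G` contains a path on `k` vertices. -/
def HasPath {V : Type*} (G : SimpleGraph V) (k : ℕ) : Prop :=
  ∃ l : List V, l.length = k ∧ l.Nodup ∧ l.IsChain G.Adj

/-! ### A search over graphs on at most nine labelled vertices -/

/-- The code of the edge joining two of the vertices `0, …, 8`. -/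
def edgeCode (a b : ℕ) : ℕ := 9 * min a b + max a b

/-- The set of edges of a path, as a bit mask. -/
def pathMask : List ℕ → ℕ
  | a :: b :: l => Nat.lor (2 ^ edgeCode a b) (pathMask (b :: l))
  | _ => 0

/-- The set of edges of the two paths formed by the first four and the other vertices. -/
def twoPathMask (l : List ℕ) : ℕ := Nat.lor (pathMask (l.take 4)) (pathMask (l.drop 4))

/-- The last `m` decimal digits of `p`, the last one first. -/
def digitList (m p : ℕ) : List ℕ := (List.range m).map fun i => p / 10 ^ i % 10

/-- Some member of `l` is contained in `m`. -/
def hit (m : ℕ) (l : List ℕ) : Bool :=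
  l.rec false fun x _ ih => cond (Nat.beq (Nat.land x m) x) true ih

/-- The intersection of the members of `l` that are contained in `m`. -/
def meet (m : ℕ) (l : List ℕ) : ℕ :=
  l.rec (2 ^ 81 - 1) fun x _ ih => cond (Nat.beq (Nat.land x m) x) (Nat.land x ih) ih

/-- For some `(f, l)` in `qs`, the members of `l` contained in `m + f` have only `f` in common. -/
def robustCheck (m : ℕ) (qs : List (ℕ × List ℕ)) : Bool :=
  qs.rec false fun q _ ih =>
    cond (Nat.beq (meet (Nat.lor m (2 ^ q.1)) q.2) (2 ^ q.1)) true ih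

/-- One step of the search: an edge to decide, the patterns that forbid it, and the candidates for
`robustCheck`. -/
structure Step where
  code : ℕ
  clauses : List ℕ
  checks : List (ℕ × List ℕ)

/-- Decide the edges of the steps one by one, where `m` is the set of edges accepted so far and at
most `b` edges may still be rejected; each branch has to end by a pattern, by a successful
`robustCheck`, or by too many rejections. -/
def search (last : List (ℕ × List ℕ)) (steps : List Step) : ℕ → ℕ → Bool :=
  steps.rec (fun _ m => robustCheck m last) fun s _ ih b m =>
    cond (robustCheck m s.checks) true
      (cond (cond (hit (Nat.lor m (2 ^ s.code)) s.clauses) true (ih b (Nat.lor m (2 ^ s.code))))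
        (b.rec true fun b' _ => ih b' m) false)

/-- Labelled copies of `2P₄` used when the path on `0, …, k - 1` is known to be present, each
written as an eight-digit word (a leading zero is dropped). -/
def twoP4Patterns : ℕ → List ℕ
  | 4 => [
      1234567, 1234568, 1234576, 1234578, 1234586, 1234587, 1234657, 1234658, 1234675, 1234678,
      1234685, 1234687, 1234756, 1234758, 1234765, 1234768, 1234785, 1234786, 1234856, 1234857,
      1234865, 1234867, 1234875, 1234876, 1235467, 1235468, 1235476, 1235478, 1235486, 1235487,
      1235647, 1235648, 1235678, 1235687, 1235746, 1235748, 1235768, 1235786, 1235846, 1235847,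
      1235867, 1235876, 1236457, 1236458, 1236478, 1236487, 1236547, 1236548, 1236578, 1236587,
      1236748, 1236758, 1236847, 1236857, 1237458, 1237468, 1237548, 1237568, 1237648, 1237658]
  | 5 => [
      1235678, 1235768, 1235867, 1236587, 1236758, 1236857, 1237568, 1237658]
  | 6 => [
      1265437, 1265438, 1275436, 1275438, 1285436, 1285437, 6781243, 6873214, 10672345, 10672543,
      10762543, 10862543, 12354068, 12354078, 12354087]
  | 7 => [
      1234567, 1234568, 1234576, 1234578, 1234586, 1234587, 1236547, 1236548, 1237458, 1256347,
      1257438, 1263457, 1263458, 1265437, 1265438, 1273456, 1275438, 1283456, 1542378, 1542387,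
      1653478, 1657238, 1762345, 1782345, 1783456, 1873456, 2173456, 2386547, 3214567, 3216547,
      3456217, 4321567, 4321568, 4371265, 4561237, 4561238, 4563217, 4563218, 5432176, 5436217,
      5471236, 5471238, 5671234, 5671432, 5672143, 6541238, 6543217, 6543218, 6571234, 6581234,
      7123456, 7321654, 7342165, 7543216, 7561234, 8123456, 10324576, 10326547, 10342567,
      10432568, 10437658, 10456237, 10542376, 10543278, 10562347, 10564327, 10567438, 10672345,
      12073456, 12345607, 12346507, 12346578, 12346587, 12347658, 12783456, 14562307, 16542307,
      16547238, 21034567, 21036547, 21054376, 21065437, 21073456, 21073546, 21075436, 21083456,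
      21564378, 21564387, 21653407, 21654307, 23456107, 23457018, 23654107, 32164507, 32165407,
      32165478, 32174065, 32184507, 32546107, 32654107, 32654108, 43265017, 43265107, 43265108]
  | _ => []

/-- Labelled paths on `k + 1` vertices used when the path on `0, …, k - 1` is known to be present,
each written as a word of `k + 1` digits (a leading zero is dropped). -/
def pathPatterns : ℕ → List ℕ
  | 1 => [
      12, 13, 14, 15, 16, 17, 23, 24, 25, 26, 27, 34, 35, 36, 37, 45, 46, 47, 56, 57]
  | 2 => [
      102, 103, 234, 235, 236, 237, 238, 243, 245, 246, 247, 248, 253, 254, 256, 257, 258, 263,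
      264, 265, 267, 268, 273, 274, 275, 276, 278, 283, 284, 285, 286, 287, 324, 325, 326, 327,
      328, 345, 346, 347, 348, 354, 356, 357, 358, 364, 365, 367, 368, 374, 375, 376, 378, 384,
      385, 386, 387, 425, 426, 427, 428, 435, 436, 437, 438, 456, 457, 458, 465, 467, 468, 475,
      476, 478, 485, 486, 487, 526, 527, 528, 536, 537, 538, 546, 547, 548, 567, 568, 576, 578,
      586, 587, 627, 628, 637, 638, 647, 648, 657, 658, 678, 687, 728, 738, 748, 758, 768]
  | 3 => [
      134, 135, 136, 137, 138, 143, 145, 146, 147, 148, 153, 154, 156, 157, 158, 163, 164, 165,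
      168, 173, 174, 175, 176, 2103, 2104, 2105, 2106, 2107, 2108, 3456, 3457, 3465, 3468, 3475,
      3476, 3478, 3485, 3546, 3547, 3548, 3564, 3567, 3574, 3576, 3578, 3586, 3645, 3647, 3654,
      3657, 3674, 3675, 3684, 3685, 3745, 3746, 3756, 3758, 3765, 3768, 3784, 3845, 3847, 3854,
      3857, 3864, 3874, 4356, 4357, 4358, 4365, 4367, 4376, 4378, 4386, 4387, 4536, 4537, 4538,
      4567, 4568, 4576, 4587, 4635, 4637, 4638, 4657, 4658, 4675, 4678, 4735, 4736, 4756, 4768,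
      4785, 4835, 4836, 4856, 4865, 4867, 4875, 4876, 5346, 5348, 5367, 5368, 5376, 5387, 5436,
      5437, 5467, 5468, 5478, 5486, 5637, 5638, 5647, 5648, 5678, 5687, 5736, 5738, 5746, 5748,
      5786, 5837, 5846, 5847, 5876, 6347, 6348, 6357, 6358, 6378, 6387, 6437, 6438, 6457, 6487,
      6537, 6538, 6547, 6587, 6738, 6748, 6758, 6837, 7348, 7438, 7458, 7468, 7548, 7568, 7658]
  | 4 => [
      1245, 1246, 1247, 1248, 1254, 1256, 1257, 1258, 1264, 1265, 1267, 1268, 1274, 1275, 1278,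
      1284, 1285, 1286, 1423, 1523, 1623, 1723, 1823, 32104, 32105, 32106, 32107, 32108, 32145,
      32146, 32147, 32148, 32154, 32156, 32157, 32158, 32164, 32165, 32167, 32168, 32174, 32175,
      32176, 32178, 32184, 32185, 32186, 32187]
  | 5 => [
      12345, 12346, 12347, 12348, 12356, 12357, 12358, 12365, 12367, 12368, 12375, 12376, 12378,
      12385, 12386, 12387, 12534, 12567, 12568, 12576, 12578, 12586, 12587, 12634, 12657, 12658,
      12675, 12678, 12685, 12687, 12734, 12756, 12758, 12765, 12768, 12785, 12786, 12834, 12856,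
      12857, 12865, 12867, 12875, 12876, 15234, 15326, 15327, 15328, 16234, 16325, 16327, 16328,
      17234, 17325, 17326, 18234, 18325, 18327, 21435, 43215, 432105, 432106, 432107, 432108,
      432156, 432157, 432158, 432165, 432167, 432168, 432175, 432176, 432178, 432185, 432186,
      432187]
  | 6 => [
      123456, 123457, 123458, 123467, 123468, 123476, 123478, 123486, 123487, 123546, 123645,
      123678, 123687, 123745, 123768, 123786, 123845, 123876, 125438, 126345, 127345, 128345,
      132547, 152346, 154236, 154326, 154327, 154328, 162345, 164327, 164328, 172345, 174326,
      174328, 182345, 184326, 184327, 215437, 216345, 234516, 321548, 321745, 543216, 543217,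
      543218, 1032645, 1032845, 1043276, 1043278, 1043286, 1054326, 2105436, 3210546, 3210547,
      3210548, 5401236, 5401237, 5401238, 5403216, 5432106, 5432107, 5432108, 5432167, 5432168,
      5432176, 5432178, 5432186, 5432187, 5432678, 5432687, 5432768, 5432786, 5432867, 5432876,
      5461237, 5461238, 5471236, 5471238, 5481236, 5481237]
  | _ => []

/-- The masks of the patterns for `2P₄` that live on the vertices below `n`. -/
def twoP4Masks (n k : ℕ) : List ℕ :=
  (((twoP4Patterns k).map (digitList 8)).filter
    fun l => l.all (fun i => decide (i < n)) && decide l.Nodup).map twoPathMask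

/-- The masks of the patterns for longer paths that live on the vertices below `n`. -/
def pathMasks (n k : ℕ) : List ℕ :=
  (((pathPatterns k).map (digitList (k + 1))).filter
    fun l => l.all (fun i => decide (i < n)) && decide l.Nodup).map pathMask

/-- The edges that meet the set of vertices from `k` on. -/
def outerEdges (n k : ℕ) : List ℕ :=
  ((List.range n).flatMap fun j => ((List.range j).filter fun i => decide (k ≤ i)).map fun i =>
    edgeCode i j) ++
  (List.range k).flatMap fun i => ((List.range n).filter fun j => decide (k ≤ j)).map fun j =>
    edgeCode i j

/-- The chords of the path `0, …, k - 1`, the long ones first. -/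
def innerEdges (k : ℕ) : List ℕ :=
  (List.range (k - 2)).flatMap fun r => (List.range (r + 1)).map fun i =>
    edgeCode i (i + (k - 1 - r))

/-- Candidates for `robustCheck`, one for each of the non-edges in `fs`. -/
def checksFor (n k : ℕ) (fs : List ℕ) : List (ℕ × List ℕ) :=
  fs.map fun f => (f, (twoP4Masks n k).filter fun x => x.testBit f)

/-- The steps of the search that starts from the path `0, …, k - 1`. -/
def searchSteps (n k : ℕ) : List Step :=
  ((outerEdges n k).map fun c =>
    ⟨c, (twoP4Masks n k ++ pathMasks n k).filter fun x => x.testBit c, []⟩) ++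
  (innerEdges k).map fun c =>
    ⟨c, (twoP4Masks n k ++ pathMasks n k).filter fun x => x.testBit c,
      if k = 7 then checksFor n k (outerEdges n k) else []⟩

/-- The candidates for `robustCheck` once all edges are decided. -/
def lastChecks (n k : ℕ) : List (ℕ × List ℕ) :=
  checksFor n k (((List.range n).filter fun j => decide (6 ≤ j)).map fun j => edgeCode 0 j)

/-- The search from the path `0, …, k - 1`, among the graphs with at least `17` edges. -/
def pathSearch (n k : ℕ) : Bool :=
  search (lastChecks n k) (searchSteps n k) (n * (n - 1) / 2 - 17) (pathMask (List.range k))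

/-! ### Meaning of the bit mask tests -/

theorem hit_eq_true {m : ℕ} {l : List ℕ} (h : hit m l = true) : ∃ x ∈ l, x &&& m = x := by
  induction l with
  | nil => exact absurd h (by simp [hit])
  | cons x l ih =>
    change cond (Nat.beq (x &&& m) x) true (hit m l) = true at h
    cases hx : Nat.beq (x &&& m) x
    · rw [hx] at h
      obtain ⟨y, hy, hym⟩ := ih h
      exact ⟨y, List.mem_cons_of_mem _ hy, hym⟩
    · exact ⟨x, List.mem_cons_self, Nat.eq_of_beq_eq_true hx⟩

theorem testBit_meet {m e : ℕ} {l : List ℕ} (he : e < 81)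
    (h : ∀ x ∈ l, x &&& m = x → x.testBit e = true) : (meet m l).testBit e = true := by
  induction l with
  | nil =>
    -- The empty intersection is the full mask, which has a bit for each of the 81 possible codes.
    change (2 ^ 81 - 1).testBit e = true
    rw [Nat.testBit_two_pow_sub_one]
    simpa using he
  | cons x l ih =>
    have ih' := ih fun y hy => h y (List.mem_cons_of_mem _ hy)
    change (cond (Nat.beq (x &&& m) x) (x &&& meet m l) (meet m l)).testBit e = true
    cases hx : Nat.beq (x &&& m) x
    · exact ih'
    · simp [ih', h x List.mem_cons_self (Nat.eq_of_beq_eq_true hx)]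

/-- If the patterns inside `m + f` have only `f` in common, each other edge is avoided by one of
them; this is the pattern that survives the deletion of that edge. -/
theorem robustCheck_eq_true {m : ℕ} {qs : List (ℕ × List ℕ)} (h : robustCheck m qs = true) :
    ∃ q ∈ qs, ∀ e < 81, e ≠ q.1 → ∃ x ∈ q.2, x &&& (m ||| 2 ^ q.1) = x ∧ x.testBit e = false := by
  induction qs with
  | nil => exact absurd h (by simp [robustCheck])
  | cons q qs ih =>
    change cond (Nat.beq (meet (m ||| 2 ^ q.1) q.2) (2 ^ q.1)) true (robustCheck m qs) = true at h
    cases hx : Nat.beq (meet (m ||| 2 ^ q.1) q.2) (2 ^ q.1)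
    · rw [hx] at h
      obtain ⟨y, hy, hym⟩ := ih h
      exact ⟨y, List.mem_cons_of_mem _ hy, hym⟩
    · refine ⟨q, List.mem_cons_self, fun e he hne => ?_⟩
      by_contra! hc
      have := testBit_meet (m := m ||| 2 ^ q.1) he fun x hx hxm => by simpa using hc x hx hxm
      rw [Nat.eq_of_beq_eq_true hx, Nat.testBit_two_pow] at this
      simp at this
      exact hne this.symm

/-! ### Soundness of the search for a labelled graph -/

section Labelled

variable {V : Type*}

/-- The edges of the mask `x`, between vertices below `n`, are edges of `R` under the labelling. -/
def MaskLE (n : ℕ) (lab : ℕ → V) (x : ℕ) (R : V → V → Prop) : Prop :=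
  ∀ i j, i < j → j < n → x.testBit (9 * i + j) = true → R (lab i) (lab j)

theorem MaskLE.of_land_eq {n x m : ℕ} {lab : ℕ → V} {R : V → V → Prop} (h : MaskLE n lab m R)
    (hx : x &&& m = x) : MaskLE n lab x R := by
  intro i j hij hj hb
  rw [← hx, Nat.testBit_land] at hb
  exact h i j hij hj (by simp_all)

theorem isChain_of_pathMask {n : ℕ} (hn : n ≤ 9) {lab : ℕ → V} {R : V → V → Prop}
    (hR : ∀ a b, R a b → R b a) : ∀ {l : List ℕ}, l.Nodup → (∀ i ∈ l, i < n) →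
    MaskLE n lab (pathMask l) R → (l.map lab).IsChain R
  | [], _, _, _ => by simp
  | [a], _, _, _ => by simp
  | a :: b :: l, hl, hlt, hm => by
    have hab : a ≠ b := by rintro rfl; simp at hl
    have ha := hlt a (by simp)
    have hb := hlt b (by simp)
    have hm' : MaskLE n lab (pathMask (b :: l)) R := fun i j hij hj h =>
      hm i j hij hj (by
        change (Nat.lor (2 ^ edgeCode a b) (pathMask (b :: l))).testBit _ = true
        exact (Nat.testBit_lor ..).trans (by simp [h]))
    have ih := isChain_of_pathMask hn hR (List.nodup_cons.1 hl).2
      (fun i hi => hlt i (List.mem_cons_of_mem _ hi)) hm'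
    have key : R (lab (min a b)) (lab (max a b)) := by
      refine hm _ _ (by omega) (by omega) ?_
      change (Nat.lor (2 ^ edgeCode a b) (pathMask (b :: l))).testBit _ = true
      refine (Nat.testBit_lor ..).trans ?_
      simp [edgeCode]
    refine List.IsChain.cons_cons ?_ ih
    rcases le_total a b with h | h
    · simpa [h] using key
    · exact hR _ _ (by simpa [h] using key)

/-- Every symmetric relation containing the mask `x` contains `2P₄`. -/
def IsTwoP4Mask (n : ℕ) (lab : ℕ → V) (x : ℕ) : Prop :=
  ∀ R : V → V → Prop, (∀ a b, R a b → R b a) → MaskLE n lab x R → HasTwoP4 R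

theorem nodup_map_of_lt {n : ℕ} {lab : ℕ → V} (hlab : Set.InjOn lab (Set.Iio n)) {l : List ℕ}
    (hl : l.Nodup) (hlt : ∀ i ∈ l, i < n) : (l.map lab).Nodup :=
  List.Nodup.map_on (fun x hx y hy h => hlab (hlt x hx) (hlt y hy) h) hl

theorem isTwoP4Mask_twoPathMask {n : ℕ} (hn : n ≤ 9) {lab : ℕ → V}
    (hlab : Set.InjOn lab (Set.Iio n)) {l : List ℕ} (hl : l.Nodup) (hlt : ∀ i ∈ l, i < n)
    (h8 : l.length = 8) : IsTwoP4Mask n lab (twoPathMask l) := by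
  intro R hR hm
  have h1 := isChain_of_pathMask hn hR (l := l.take 4) (lab := lab) (hl.sublist (List.take_sublist _ _))
    (fun i hi => hlt i (List.mem_of_mem_take hi)) fun i j hij hj h =>
      hm i j hij hj ((Nat.testBit_lor ..).trans (by simp [h]))
  have h2 := isChain_of_pathMask hn hR (l := l.drop 4) (lab := lab) (hl.sublist (List.drop_sublist _ _))
    (fun i hi => hlt i (List.mem_of_mem_drop hi)) fun i j hij hj h =>
      hm i j hij hj ((Nat.testBit_lor ..).trans (by simp [h]))
  have hd := nodup_map_of_lt hlab hl hlt
  match l, h8 with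
  | [a, b, c, d, e, f, g, h], _ =>
    simp only [List.take_succ_cons, List.take_zero, List.drop_succ_cons, List.drop_zero,
      List.map_cons, List.map_nil, List.isChain_cons_cons, List.isChain_singleton] at h1 h2
    exact ⟨_, _, _, _, _, _, _, _, hd, h1.1, h1.2.1, h1.2.2.1, h2.1, h2.2.1, h2.2.2.1⟩

/-- The filter in `twoP4Masks` keeps only words with distinct digits below `n`, so nothing has to be
known about the table of patterns. -/
theorem mem_twoP4Masks {n k x : ℕ} (hn : n ≤ 9) {lab : ℕ → V}
    (hlab : Set.InjOn lab (Set.Iio n)) (hx : x ∈ twoP4Masks n k) : IsTwoP4Mask n lab x := by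
  simp only [twoP4Masks, List.mem_map, List.mem_filter, Bool.and_eq_true, List.all_eq_true,
    decide_eq_true_eq] at hx
  obtain ⟨l, ⟨⟨p, -, rfl⟩, hlt, hl⟩, rfl⟩ := hx
  exact isTwoP4Mask_twoPathMask hn hlab hl hlt (by simp [digitList])

theorem mem_pathMasks {n k x : ℕ} (hn : n ≤ 9) {lab : ℕ → V} (hlab : Set.InjOn lab (Set.Iio n))
    (hx : x ∈ pathMasks n k) {G : SimpleGraph V} (hG : MaskLE n lab x G.Adj) :
    HasPath G (k + 1) := by
  simp only [pathMasks, List.mem_map, List.mem_filter, Bool.and_eq_true, List.all_eq_true,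
    decide_eq_true_eq] at hx
  obtain ⟨l, ⟨⟨p, -, rfl⟩, hlt, hl⟩, rfl⟩ := hx
  exact ⟨_, by simp [digitList], nodup_map_of_lt hlab hl hlt,
    isChain_of_pathMask hn (fun _ _ h => h.symm) hl hlt hG⟩

/-- The number `c` is the code of an edge on the vertices below `n`. -/
def IsEdgeCode (n c : ℕ) : Prop := ∃ i j, i < j ∧ j < n ∧ c = 9 * i + j

theorem isRobust_of_robustCheck {n m : ℕ} (hn : n ≤ 9) (hn2 : 3 ≤ n) {lab : ℕ → V}
    (hlab : Set.InjOn lab (Set.Iio n)) (hsurj : ∀ v, ∃ i < n, lab i = v) {G : SimpleGraph V}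
    {qs : List (ℕ × List ℕ)} (hq : ∀ q ∈ qs, IsEdgeCode n q.1 ∧ ∀ x ∈ q.2, IsTwoP4Mask n lab x)
    (hm : MaskLE n lab m G.Adj) (h : robustCheck m qs = true) : IsRobust G := by
  obtain ⟨⟨f, l⟩, hql, hall⟩ := robustCheck_eq_true h
  obtain ⟨⟨p, q, hpq, hqn, rfl⟩, hl⟩ := hq _ hql
  simp only at hall hl
  -- The mask `m` records only accepted edges, so the candidate may already be an edge of `G`. Then
  -- any pattern inside `m + f` lies in `G`; some code other than that of `f` is needed only to
  -- extract one.
  by_cases hf : G.Adj (lab p) (lab q)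
  · obtain ⟨e, he, hne⟩ : ∃ e < 81, e ≠ 9 * p + q := by
      by_cases h0 : 9 * p + q = 0
      · exact ⟨1, by omega, by omega⟩
      · exact ⟨0, by omega, by omega⟩
    obtain ⟨x, hx, hxm, -⟩ := hall e he hne
    refine Or.inl (hl x hx _ (fun _ _ h => h.symm) ?_)
    refine MaskLE.of_land_eq (fun i j hij hj hb => ?_) hxm
    rw [Nat.testBit_lor, Nat.testBit_two_pow] at hb
    simp only [Bool.or_eq_true, decide_eq_true_eq] at hb
    rcases hb with hb | hb
    · exact hm i j hij hj hb
    · obtain ⟨rfl, rfl⟩ : p = i ∧ q = j := by omega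
      exact hf
  refine Or.inr ⟨lab p, lab q, fun h => ?_, hf, ?_⟩
  · have := hlab (show p < n by omega) hqn h
    omega
  have main : ∀ a b, a < b → b < n → G.Adj (lab a) (lab b) →
      HasTwoP4 fun x y => (G.Adj x y ∨ s(x, y) = s(lab p, lab q)) ∧
        s(x, y) ≠ s(lab a, lab b) := by
    intro a b hab hb hadj
    have hne : 9 * a + b ≠ 9 * p + q := by
      intro h
      obtain ⟨rfl, rfl⟩ : a = p ∧ b = q := by omega
      exact hf hadj
    obtain ⟨x, hx, hxm, hxb⟩ := hall (9 * a + b) (by omega) hne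
    refine hl x hx _ (fun u v h => ?_) ?_
    · rwa [G.adj_comm, Sym2.eq_swap] at h
    intro i j hij hj hb'
    refine ⟨?_, fun hs => ?_⟩
    · have hb2 := hb'
      rw [← hxm, Nat.testBit_land, Nat.testBit_lor, Nat.testBit_two_pow] at hb2
      simp only [Bool.and_eq_true, Bool.or_eq_true, decide_eq_true_eq] at hb2
      rcases hb2.2 with hb2 | hb2
      · exact Or.inl (hm i j hij hj hb2)
      · obtain ⟨rfl, rfl⟩ : p = i ∧ q = j := by omega
        exact Or.inr rfl
    · have hia : i = a ∧ j = b := by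
        rcases Sym2.eq_iff.1 hs with ⟨h1, h2⟩ | ⟨h1, h2⟩
        · exact ⟨hlab (show i < n by omega) (show a < n by omega) h1, hlab hj hb h2⟩
        · have h1 := hlab (show i < n by omega) hb h1
          have h2 := hlab hj (show a < n by omega) h2
          omega
      obtain ⟨rfl, rfl⟩ := hia
      rw [hxb] at hb'
      exact absurd hb' (by simp)
  intro u v huv
  obtain ⟨a, ha, rfl⟩ := hsurj u
  obtain ⟨b, hb, rfl⟩ := hsurj v
  rcases lt_trichotomy a b with hab | rfl | hab
  · exact main a b hab hb huv
  · exact absurd huv (by simp)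
  · have := main b a hab ha huv.symm
    rwa [Sym2.eq_swap (a := lab b)] at this

/-- The graph `G` itself selects a branch of the search: accept its edges, reject its non-edges.
Along this branch `m` stays inside `G`, and the set `t` of size at most `b` contains all non-edges
still to be met, so the branch cannot run out of rejections and must end in one of the other ways.
-/
theorem of_search {n k : ℕ} (hn : n ≤ 9) (hn2 : 3 ≤ n) {lab : ℕ → V}
    (hlab : Set.InjOn lab (Set.Iio n)) (hsurj : ∀ v, ∃ i < n, lab i = v) {G : SimpleGraph V}
    {last : List (ℕ × List ℕ)}
    (hlast : ∀ q ∈ last, IsEdgeCode n q.1 ∧ ∀ x ∈ q.2, IsTwoP4Mask n lab x) (steps : List Step)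
    (hsteps : ∀ s ∈ steps, IsEdgeCode n s.code ∧
      (∀ x ∈ s.clauses, MaskLE n lab x G.Adj → IsRobust G ∨ HasPath G k) ∧
      ∀ q ∈ s.checks, IsEdgeCode n q.1 ∧ ∀ x ∈ q.2, IsTwoP4Mask n lab x)
    (b m : ℕ) (h : search last steps b m = true) (hm : MaskLE n lab m G.Adj)
    (hb : ∃ t : Finset ℕ, t.card ≤ b ∧ (steps.map Step.code).Nodup ∧
      ∀ i j, i < j → j < n → 9 * i + j ∈ steps.map Step.code → ¬ G.Adj (lab i) (lab j) →
        9 * i + j ∈ t) :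
    IsRobust G ∨ HasPath G k := by
  induction steps generalizing b m with
  | nil => exact Or.inl (isRobust_of_robustCheck hn hn2 hlab hsurj hlast hm h)
  | cons s l ih =>
    obtain ⟨⟨i, j, hij, hj, hc⟩, hcl, hch⟩ := hsteps s List.mem_cons_self
    have hl : ∀ s ∈ l, _ := fun s hs => hsteps s (List.mem_cons_of_mem _ hs)
    obtain ⟨t, htb, hnd, ht⟩ := hb
    rw [List.map_cons, List.nodup_cons] at hnd
    change cond (robustCheck m s.checks) true (cond (cond (hit (m ||| 2 ^ s.code) s.clauses) true
      (search last l b (m ||| 2 ^ s.code))) (b.rec true fun b' _ => search last l b' m) false)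
      = true at h
    cases hr : robustCheck m s.checks
    swap
    · exact Or.inl (isRobust_of_robustCheck hn hn2 hlab hsurj hch hm hr)
    rw [hr, cond_false, Bool.cond_false_right, Bool.and_eq_true] at h
    obtain ⟨h1, h2⟩ := h
    by_cases hadj : G.Adj (lab i) (lab j)
    · have hm' : MaskLE n lab (m ||| 2 ^ s.code) G.Adj := by
        intro i' j' hij' hj' hbit
        rw [Nat.testBit_lor, Nat.testBit_two_pow, hc] at hbit
        simp only [Bool.or_eq_true, decide_eq_true_eq] at hbit
        rcases hbit with hbit | hbit
        · exact hm i' j' hij' hj' hbit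
        · obtain ⟨rfl, rfl⟩ : i = i' ∧ j = j' := by omega
          exact hadj
      cases hh : hit (m ||| 2 ^ s.code) s.clauses
      · rw [hh] at h1
        exact ih hl b _ h1 hm' ⟨t, htb, hnd.2, fun i' j' hij' hj' hmem hn' =>
          ht i' j' hij' hj' (List.mem_cons_of_mem _ hmem) hn'⟩
      · obtain ⟨x, hx, hxm⟩ := hit_eq_true hh
        exact hcl x hx (hm'.of_land_eq hxm)
    · have hct : s.code ∈ t := hc ▸ ht i j hij hj (by simp [hc]) hadj
      -- With no rejection left `t` would be empty, but it contains the present code. Otherwise the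
      -- code is removed from `t`; as codes do not repeat, it is not needed again.
      cases b with
      | zero => simp_all
      | succ b =>
        refine ih hl b m h2 hm ⟨t.erase s.code, ?_, hnd.2, fun i' j' hij' hj' hmem hn' => ?_⟩
        · rw [Finset.card_erase_of_mem hct]
          omega
        · refine Finset.mem_erase.2 ⟨?_, ht i' j' hij' hj' (List.mem_cons_of_mem _ hmem) hn'⟩
          intro h
          exact hnd.1 (h ▸ hmem)

end Labelled

/-! ### Eight or nine vertices -/

-- Finite computations. The pattern tables serve as hints: an unsuitable entry could make a search
-- fail but could not make its success misleading.
set_option maxRecDepth 100000 in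
theorem pathSearch_eight : ∀ k ∈ [1, 2, 3, 4, 5, 6, 7], pathSearch 8 k = true := by decide +kernel

set_option maxRecDepth 100000 in
theorem pathSearch_nine : ∀ k ∈ [1, 2, 3, 4, 5, 6, 7], pathSearch 9 k = true := by decide +kernel

theorem codes_searchSteps (n k : ℕ) :
    (searchSteps n k).map Step.code = outerEdges n k ++ innerEdges k := by
  simp [searchSteps, Function.comp_def]

theorem nodup_codes : ∀ n ∈ [8, 9], ∀ k ∈ [1, 2, 3, 4, 5, 6, 7],
    (outerEdges n k ++ innerEdges k).Nodup := by
  decide +kernel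

theorem codes_valid : ∀ n ∈ [8, 9], ∀ k ∈ [1, 2, 3, 4, 5, 6, 7],
    ∀ c ∈ outerEdges n k ++ innerEdges k, c / 9 < c % 9 ∧ c % 9 < n := by
  decide +kernel

theorem testBit_pathMask_range : ∀ k ∈ [1, 2, 3, 4, 5, 6, 7], ∀ i < 9, ∀ j < 9,
    (pathMask (List.range k)).testBit (9 * i + j) = true → j = i + 1 ∧ j < k := by
  decide +kernel

section

variable {V : Type*} {G : SimpleGraph V}

/-- A path can be continued to a labelling of all vertices. -/
theorem HasPath.exists_labelling [Fintype V] {n k : ℕ} (hV : Fintype.card V = n) (hn : 0 < n)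
    (h : HasPath G k) : ∃ lab : ℕ → V, Set.InjOn lab (Set.Iio n) ∧ (∀ v, ∃ i < n, lab i = v) ∧
      ∀ i, i + 1 < k → G.Adj (lab i) (lab (i + 1)) := by
  classical
  obtain ⟨l, hlk, hnd, hch⟩ := h
  have : Nonempty V := Fintype.card_pos_iff.1 (by omega)
  -- The path comes first, then the other vertices in any order.
  let L := l ++ (Finset.univ \ l.toFinset).toList
  have hLnd : L.Nodup := by
    refine List.Nodup.append hnd (Finset.nodup_toList _) fun x hx hx' => ?_
    simp [hx] at hx'
  have hLmem : ∀ v, v ∈ L := fun v => by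
    by_cases hv : v ∈ l <;> simp [L, hv]
  have hLn : L.length = n := by
    rw [← hV, ← List.toFinset_card_of_nodup hLnd, ← Finset.card_univ]
    congr 1
    ext v
    simpa using hLmem v
  refine ⟨fun i => L.getD i (Classical.arbitrary V), ?_, fun v => ?_, fun i hi => ?_⟩
  · intro i hi j hj hij
    simp only [Set.mem_Iio] at hi hj
    simp only at hij
    rw [List.getD_eq_getElem _ _ (by omega), List.getD_eq_getElem _ _ (by omega)] at hij
    exact (List.Nodup.getElem_inj_iff hLnd).1 hij
  · obtain ⟨i, hi, rfl⟩ := List.getElem_of_mem (hLmem v)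
    exact ⟨i, by omega, List.getD_eq_getElem _ _ hi⟩
  · have hlen : k ≤ L.length := by simp [L, hlk]
    simp only
    rw [List.getD_eq_getElem _ _ (by omega), List.getD_eq_getElem _ _ (by omega)]
    simp only [L]
    rw [List.getElem_append_left (by omega), List.getElem_append_left (by omega)]
    exact List.isChain_iff_getElem.1 hch i (by omega)

/-- Number the vertices so that the given path is `0, …, k - 1`. At least 17 edges leave at most
`n(n - 1)/2 - 17` non-edges, which is the number of rejections allowed in `pathSearch`. -/
theorem HasPath.succ_of_pathSearch [Fintype V] [DecidableRel G.Adj] {n k : ℕ}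
    (hn : n ∈ [8, 9]) (hk : k ∈ [1, 2, 3, 4, 5, 6, 7]) (hV : Fintype.card V = n)
    (hG : 17 ≤ G.edgeFinset.card) (hs : pathSearch n k = true) (h : HasPath G k) :
    IsRobust G ∨ HasPath G (k + 1) := by
  classical
  have hcodes := codes_valid n hn k hk
  have hn9 : n ≤ 9 ∧ 8 ≤ n := by simp at hn; omega
  have hP : ((Finset.range n ×ˢ Finset.range n).filter fun p => p.1 < p.2).card
      = n * (n - 1) / 2 := by
    simp only [List.mem_cons, List.not_mem_nil, or_false] at hn
    rcases hn with rfl | rfl <;> decide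
  obtain ⟨lab, hlab, hsurj, hadj⟩ := h.exists_labelling hV (by omega)
  have hcode : ∀ c ∈ outerEdges n k ++ innerEdges k, IsEdgeCode n c := fun c hc =>
    ⟨c / 9, c % 9, (hcodes c hc).1, (hcodes c hc).2, by omega⟩
  have hchecks : ∀ fs : List ℕ, (∀ c ∈ fs, IsEdgeCode n c) → ∀ q ∈ checksFor n k fs,
      IsEdgeCode n q.1 ∧ ∀ x ∈ q.2, IsTwoP4Mask n lab x := by
    intro fs hfs q hq
    obtain ⟨f, hf, rfl⟩ := List.mem_map.1 hq
    exact ⟨hfs f hf, fun x hx => mem_twoP4Masks hn9.1 hlab (List.mem_filter.1 hx).1⟩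
  have hclauses : ∀ c, ∀ x ∈ (twoP4Masks n k ++ pathMasks n k).filter (fun x => x.testBit c),
      MaskLE n lab x G.Adj → IsRobust G ∨ HasPath G (k + 1) := by
    intro c x hx hxG
    rcases List.mem_append.1 (List.mem_filter.1 hx).1 with hx | hx
    · exact Or.inl (Or.inl (mem_twoP4Masks hn9.1 hlab hx _ (fun _ _ h => h.symm) hxG))
    · exact Or.inr (mem_pathMasks hn9.1 hlab hx hxG)
  refine of_search hn9.1 (by omega) hlab hsurj (hchecks _ ?_) _ ?_ _ _ hs ?_ ?_
  · intro c hc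
    obtain ⟨j, hj, rfl⟩ := List.mem_map.1 hc
    simp only [List.mem_filter, List.mem_range, decide_eq_true_eq] at hj
    exact ⟨0, j, by omega, hj.1, by simp [edgeCode]⟩
  · intro s hs
    rcases List.mem_append.1 hs with hs | hs <;> obtain ⟨c, hc, rfl⟩ := List.mem_map.1 hs
    · exact ⟨hcode c (List.mem_append_left _ hc), hclauses c, by simp⟩
    · refine ⟨hcode c (List.mem_append_right _ hc), hclauses c, ?_⟩
      simp only
      split_ifs
      · exact hchecks _ fun c hc => hcode c (List.mem_append_left _ hc)
      · simp
  · intro i j hij hj hb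
    obtain ⟨rfl, hjk⟩ := testBit_pathMask_range k hk i (by omega) j (by omega) hb
    exact hadj i hjk
  · have hE : 17 ≤ (((Finset.range n ×ˢ Finset.range n).filter fun p => p.1 < p.2).filter
        fun p => G.Adj (lab p.1) (lab p.2)).card := by
      refine hG.trans ((Finset.card_le_card (t := Finset.image (fun p => s(lab p.1, lab p.2))
        (((Finset.range n ×ˢ Finset.range n).filter fun p => p.1 < p.2).filter
          fun p => G.Adj (lab p.1) (lab p.2))) fun e he => ?_).trans Finset.card_image_le)
      induction e with | _ u v
      rw [mem_edgeFinset, mem_edgeSet] at he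
      obtain ⟨i, hi, rfl⟩ := hsurj u
      obtain ⟨j, hj, rfl⟩ := hsurj v
      rw [Finset.mem_image]
      rcases lt_trichotomy i j with hij | rfl | hij
      · exact ⟨(i, j), by simp [hi, hj, hij, he], rfl⟩
      · exact absurd he (by simp)
      · exact ⟨(j, i), by simp [hi, hj, hij, he.symm], Sym2.eq_swap⟩
    refine ⟨(((Finset.range n ×ˢ Finset.range n).filter fun p => p.1 < p.2).filter
        fun p => ¬ G.Adj (lab p.1) (lab p.2)).image fun p => 9 * p.1 + p.2, ?_, ?_, ?_⟩
    · refine Finset.card_image_le.trans ?_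
      have := Finset.card_filter_add_card_filter_not
        (s := (Finset.range n ×ˢ Finset.range n).filter fun p => p.1 < p.2)
        (fun p => G.Adj (lab p.1) (lab p.2))
      omega
    · rw [codes_searchSteps]
      exact nodup_codes n hn k hk
    · intro i j hij hj _ hna
      exact Finset.mem_image.2 ⟨(i, j), by simp [hj, hij, hna]; omega, rfl⟩

theorem HasPath.hasTwoP4 (h : HasPath G 8) : HasTwoP4 G.Adj := by
  obtain ⟨l, hl, hnd, hch⟩ := h
  match l, hl with
  | [a, b, c, d, e, f, g, h], _ =>
    simp only [List.isChain_cons_cons, List.isChain_singleton] at hch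
    exact ⟨_, _, _, _, _, _, _, _, hnd, hch.1, hch.2.1, hch.2.2.1, hch.2.2.2.2.1,
      hch.2.2.2.2.2.1, hch.2.2.2.2.2.2.1⟩

/-- A graph on eight or nine vertices with at least `17` edges is robust. -/
theorem isRobust_of_card_eight_or_nine [Fintype V] [DecidableRel G.Adj]
    (hV : Fintype.card V = 8 ∨ Fintype.card V = 9) (hG : 17 ≤ G.edgeFinset.card) :
    IsRobust G := by
  by_contra hr
  have step : ∀ k ∈ [1, 2, 3, 4, 5, 6, 7], HasPath G k → HasPath G (k + 1) := by
    intro k hk h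
    rcases hV with hV | hV
    · exact (h.succ_of_pathSearch (by simp) hk hV hG (pathSearch_eight k hk)).resolve_left hr
    · exact (h.succ_of_pathSearch (by simp) hk hV hG (pathSearch_nine k hk)).resolve_left hr
  have : Nonempty V := Fintype.card_pos_iff.1 (by omega)
  have h1 : HasPath G 1 := ⟨[Classical.arbitrary V], by simp⟩
  exact hr (Or.inl (step 7 (by simp) (step 6 (by simp) (step 5 (by simp) (step 4 (by simp)
    (step 3 (by simp) (step 2 (by simp) (step 1 (by simp) h1))))))).hasTwoP4)

end

/-! ### Longest paths in graphs of minimum degree at least three -/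

section

variable {V : Type*} {G : SimpleGraph V}

theorem exists_adj_notMem [Fintype V] [DecidableEq V] [DecidableRel G.Adj] {v : V} (s : Finset V)
    (h : s.card < G.degree v) : ∃ u ∉ s, G.Adj v u := by
  obtain ⟨u, hu, hus⟩ := Finset.exists_mem_notMem_of_card_lt_card h
  exact ⟨u, hus, (G.mem_neighborFinset v u).1 hu⟩

theorem subset_neighborFinset_of_degree [Fintype V] [DecidableEq V] [DecidableRel G.Adj] {v : V}
    (s : Finset V) (h : s.card ≤ G.degree v) (hs : ∀ u, G.Adj v u → u ∈ s) {u : V} (hu : u ∈ s) :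
    G.Adj v u := by
  have : G.neighborFinset v = s :=
    Finset.eq_of_subset_of_card_le (fun u hu => hs u ((G.mem_neighborFinset v u).1 hu)) h
  rwa [← G.mem_neighborFinset, this]

theorem degree_le_of_forall_adj_mem [Fintype V] [DecidableEq V] [DecidableRel G.Adj] {v : V}
    (s : Finset V) (hs : ∀ u, G.Adj v u → u ∈ s) : G.degree v ≤ s.card :=
  Finset.card_le_card fun u hu => hs u ((G.mem_neighborFinset v u).1 hu)

/-- If the ends of a longest path are adjacent, no edge leaves the path. -/
theorem mem_of_adj_of_isChain_of_ends {k : ℕ} {l : List V} (hl : l.length = k) (hnd : l.Nodup)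
    (hch : l.IsChain G.Adj) (hends : ∀ x ∈ l.getLast?, ∀ y ∈ l.head?, G.Adj x y)
    (hk : ¬ HasPath G (k + 1)) {x y : V} (hx : x ∈ l) (hxy : G.Adj x y) : y ∈ l := by
  by_contra hy
  obtain ⟨s, t, rfl⟩ := List.append_of_mem hx
  refine hk ⟨y :: (x :: t ++ s), ?_, ?_, ?_⟩
  · simp at hl ⊢; omega
  · refine List.nodup_cons.2 ⟨?_, List.nodup_append_comm.1 hnd⟩
    simp at hy ⊢
    tauto
  · refine List.IsChain.cons_cons hxy.symm ?_
    rw [List.isChain_append] at hch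
    refine List.isChain_append.2 ⟨hch.2.1, hch.1, fun a ha b hb => hends a ?_ b ?_⟩
    · rw [List.getLast?_append]
      simp_all
    · rw [List.head?_append]
      simp_all

/-- If a longest path has crossing chords at its two ends, no edge leaves the path. -/
theorem mem_of_adj_of_isChain_of_crossing {k : ℕ} {l₁ l₂ : List V} {a b c d : V}
    (hl : (l₁ ++ l₂).length = k) (hnd : (l₁ ++ l₂).Nodup) (hch : (l₁ ++ l₂).IsChain G.Adj)
    (ha : l₁.head? = some a) (hb : l₁.getLast? = some b) (hc : l₂.head? = some c)
    (hd : l₂.getLast? = some d) (hac : G.Adj a c) (hbd : G.Adj b d)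
    (hk : ¬ HasPath G (k + 1)) {x y : V} (hx : x ∈ l₁ ++ l₂) (hxy : G.Adj x y) :
    y ∈ l₁ ++ l₂ := by
  rw [List.isChain_append] at hch
  have := mem_of_adj_of_isChain_of_ends (l := l₁.reverse ++ l₂) (k := k) (by simpa using hl)
    ((List.reverse_perm l₁).append_right l₂ |>.nodup_iff.2 hnd)
    (List.isChain_append.2 ⟨List.isChain_reverse.2 (hch.1.imp fun _ _ h => h.symm), hch.2.1, by
      simpa [ha, hc] using hac⟩)
    (by simpa [List.getLast?_append, List.head?_append, hb, hd] using hbd.symm) hk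
    (x := x) (y := y) (by simpa using hx) hxy
  simpa using this

/-- In a graph of minimum degree at least three, no edge leaves a longest path on at most six
vertices. -/
theorem mem_of_adj_of_longest [Fintype V] [DecidableRel G.Adj]
    (hdeg : ∀ v, 3 ≤ G.degree v) {k : ℕ} (hk0 : 2 ≤ k) (hk6 : k ≤ 6) {l : List V}
    (hl : l.length = k) (hnd : l.Nodup) (hch : l.IsChain G.Adj) (hk : ¬ HasPath G (k + 1))
    {x y : V} (hx : x ∈ l) (hxy : G.Adj x y) : y ∈ l := by
  classical
  have h0 : 0 < l.length := by omega
  have hfirst : ∀ u, G.Adj l[0] u → u ∈ l := by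
    intro u hu
    by_contra hul
    refine hk ⟨u :: l, by simp [hl], List.nodup_cons.2 ⟨hul, hnd⟩, ?_⟩
    cases l with
    | nil => simp at h0
    | cons a l => exact List.IsChain.cons_cons hu.symm hch
  have hlast : ∀ u, G.Adj l[l.length - 1] u → u ∈ l := by
    intro u hu
    by_contra hul
    refine hk ⟨l ++ [u], by simp [hl], ?_, List.isChain_append.2 ⟨hch, by simp, ?_⟩⟩
    · rw [List.nodup_append_comm]
      exact List.nodup_cons.2 ⟨hul, hnd⟩
    · simp only [List.getLast?_eq_getElem?, List.head?_cons, Option.mem_def, Option.some.injEq]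
      rintro a ha b rfl
      rw [List.getElem?_eq_getElem (by omega), Option.some.injEq] at ha
      exact ha ▸ hu
  -- All neighbours of the two ends lie on the path. The neighbours of the first vertex are indexed
  -- with a shift by one, so that an index common to this set and the next one gives crossing
  -- chords.
  have hA : 3 ≤ ((Finset.range (k - 1)).filter fun i =>
      ∃ h : i + 1 < l.length, G.Adj l[0] l[i + 1]).card := by
    refine (hdeg l[0]).trans ((Finset.card_le_card (fun u hu => ?_)).trans
      (Finset.card_image_le (f := fun i => l.getD (i + 1) l[0])))
    rw [G.mem_neighborFinset] at hu
    obtain ⟨i, hi, rfl⟩ := List.getElem_of_mem (hfirst u hu)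
    have : i ≠ 0 := by rintro rfl; exact G.loopless.irrefl _ hu
    obtain ⟨i, rfl⟩ := Nat.exists_eq_succ_of_ne_zero this
    exact Finset.mem_image.2 ⟨i, by simp; exact ⟨by omega, hi, hu⟩, List.getD_eq_getElem _ _ hi⟩
  have hB : 3 ≤ ((Finset.range (k - 1)).filter fun i =>
      ∃ h : i < l.length, G.Adj l[i] l[l.length - 1]).card := by
    refine (hdeg l[l.length - 1]).trans ((Finset.card_le_card (fun u hu => ?_)).trans
      (Finset.card_image_le (f := fun i => l.getD i l[0])))
    rw [G.mem_neighborFinset] at hu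
    obtain ⟨i, hi, rfl⟩ := List.getElem_of_mem (hlast u hu)
    have : i ≠ l.length - 1 := by rintro rfl; exact G.loopless.irrefl _ hu
    exact Finset.mem_image.2
      ⟨i, by simp; exact ⟨by omega, hi, hu.symm⟩, List.getD_eq_getElem _ _ hi⟩
  -- Two sets of at least three indices among `k - 1 ≤ 5` must meet.
  obtain ⟨i, hi⟩ : (((Finset.range (k - 1)).filter fun i =>
      ∃ h : i + 1 < l.length, G.Adj l[0] l[i + 1]) ∩ ((Finset.range (k - 1)).filter fun i =>
      ∃ h : i < l.length, G.Adj l[i] l[l.length - 1])).Nonempty := by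
    rw [Finset.nonempty_iff_ne_empty]
    intro hempty
    have h1 := Finset.card_union_of_disjoint (Finset.disjoint_iff_inter_eq_empty.2 hempty)
    have h2 := Finset.card_le_card (Finset.union_subset
      (Finset.filter_subset (fun i => ∃ h : i + 1 < l.length, G.Adj l[0] l[i + 1])
        (Finset.range (k - 1)))
      (Finset.filter_subset (fun i => ∃ h : i < l.length, G.Adj l[i] l[l.length - 1])
        (Finset.range (k - 1))))
    rw [Finset.card_range] at h2
    omega
  simp only [Finset.mem_inter, Finset.mem_filter, Finset.mem_range] at hi
  obtain ⟨⟨hik, hi1, hadj1⟩, -, hi2, hadj2⟩ := hi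
  have happ : l.take (i + 1) ++ l.drop (i + 1) = l := List.take_append_drop _ _
  rw [← happ] at hx ⊢
  refine mem_of_adj_of_isChain_of_crossing (k := k) (a := l[0]) (b := l[i]) (c := l[i + 1])
    (d := l[l.length - 1]) (by rwa [happ]) (by rwa [happ]) (by rwa [happ]) ?_ ?_ ?_ ?_ hadj1 hadj2
    hk hx hxy
  · rw [List.head?_take, if_neg (by omega), List.head?_eq_getElem?, List.getElem?_eq_getElem h0]
  · simp [List.getLast?_eq_getElem?, hi1.le]
  · rw [List.head?_drop, List.getElem?_eq_getElem hi1]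
  · rw [List.getLast?_drop, if_neg (by omega), List.getLast?_eq_getElem?,
      List.getElem?_eq_getElem (by omega)]

/-- In a graph of minimum degree at least three there are paths on four vertices. -/
theorem exists_path_four [Fintype V] [DecidableRel G.Adj] (hdeg : ∀ v, 3 ≤ G.degree v) (a : V) :
    ∃ b c d, [a, b, c, d].Nodup ∧ G.Adj a b ∧ G.Adj b c ∧ G.Adj c d := by
  classical
  obtain ⟨b, -, hb⟩ := exists_adj_notMem (G := G) (v := a) ∅ ((by simp : _ < 3).trans_le (hdeg a))
  obtain ⟨c, hca, hc⟩ := exists_adj_notMem (G := G) (v := b) {a}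
    ((by simp : _ < 3).trans_le (hdeg b))
  obtain ⟨d, hd, hcd⟩ := exists_adj_notMem (G := G) (v := c) {a, b}
    ((Finset.card_le_two.trans_lt (by simp : 2 < 3)).trans_le (hdeg c))
  refine ⟨b, c, d, ?_, hb, hc, hcd⟩
  have := hb.ne
  have := hc.ne
  have := hcd.ne
  simp at hca hd ⊢
  grind

/-- A graph of minimum degree at least three on more than six vertices contains `2P₄` or a path on
seven vertices. -/
theorem hasPath_seven [Fintype V] [DecidableRel G.Adj] (hdeg : ∀ v, 3 ≤ G.degree v)
    (hV : 7 ≤ Fintype.card V) (hG : ¬ HasTwoP4 G.Adj) : HasPath G 7 := by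
  classical
  -- If no path is longer, no edge leaves this one. A path on four vertices that starts outside then
  -- stays outside, and forms `2P₄` with the first four vertices of the path.
  have step : ∀ k, 4 ≤ k → k ≤ 6 → HasPath G k → HasPath G (k + 1) := by
    rintro k h4 h6 ⟨l, hl, hnd, hch⟩
    by_contra hk
    have hclosed : ∀ x y, x ∈ l → G.Adj x y → y ∈ l := fun x y hx hxy =>
      mem_of_adj_of_longest hdeg (by omega) h6 hl hnd hch hk hx hxy
    obtain ⟨e, -, he⟩ : ∃ e ∈ Finset.univ, e ∉ l.toFinset :=
      Finset.exists_mem_notMem_of_card_lt_card (by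
        rw [List.toFinset_card_of_nodup hnd, Finset.card_univ]; omega)
    rw [List.mem_toFinset] at he
    obtain ⟨f, g, h, hd, hef, hfg, hgh⟩ := exists_path_four hdeg e
    have hf : f ∉ l := fun hf => he (hclosed f e hf hef.symm)
    have hg : g ∉ l := fun hg => hf (hclosed g f hg hfg.symm)
    have hh : h ∉ l := fun hh => hg (hclosed h g hh hgh.symm)
    match l, hl with
    | a :: b :: c :: d :: l, _ =>
      simp only [List.isChain_cons_cons] at hch
      refine hG ⟨a, b, c, d, e, f, g, h, ?_, hch.1, hch.2.1, hch.2.2.1, hef, hfg, hgh⟩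
      simp at hd hnd he hf hg hh ⊢
      grind
    | [], h' => simp at h'; omega
    | [_], h' => simp at h'; omega
    | [_, _], h' => simp at h'; omega
    | [_, _, _], h' => simp at h'; omega
  have : Nonempty V := Fintype.card_pos_iff.1 (by omega)
  obtain ⟨b, c, d, hd, h1, h2, h3⟩ := exists_path_four hdeg (Classical.arbitrary V)
  exact step 6 (by simp) (by simp) (step 5 (by simp) (by simp) (step 4 (by simp) (by simp)
    ⟨_, rfl, hd, by simp [h1, h2, h3]⟩))

end

/-! ### Vertices outside a path on seven vertices -/

section

variable {V : Type*} {G : SimpleGraph V}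

/-- The vertices `a, b, c, d, e, f, g` form a path of `G` in this order. -/
structure IsSevenPath (G : SimpleGraph V) (a b c d e f g : V) : Prop where
  nodup : [a, b, c, d, e, f, g].Nodup
  ab : G.Adj a b
  bc : G.Adj b c
  cd : G.Adj c d
  de : G.Adj d e
  ef : G.Adj e f
  fg : G.Adj f g

variable {a b c d e f g w w' : V}

theorem IsSevenPath.reverse (h : IsSevenPath G a b c d e f g) : IsSevenPath G g f e d c b a :=
  ⟨List.nodup_reverse.1 (by simpa using h.nodup), h.fg.symm, h.ef.symm, h.de.symm, h.cd.symm,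
    h.bc.symm, h.ab.symm⟩

/-- Otherwise `w a b c` or `w c b a` is a path disjoint from `d e f g`. -/
theorem IsSevenPath.not_adj_outside (h : IsSevenPath G a b c d e f g) (hG : ¬ HasTwoP4 G.Adj)
    (hw : w ∉ [a, b, c, d, e, f, g]) : ¬ G.Adj w a ∧ ¬ G.Adj w c := by
  obtain ⟨hnd, hab, hbc, hcd, hde, hef, hfg⟩ := h
  simp at hnd hw
  refine ⟨fun h => hG ⟨w, a, b, c, d, e, f, g, ?_, h, hab, hbc, hde, hef, hfg⟩,
    fun h => hG ⟨w, c, b, a, d, e, f, g, ?_, h, hbc.symm, hab.symm, hde, hef, hfg⟩⟩ <;>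
  · simp
    grind

/-- A neighbour of a vertex outside a path on seven vertices. -/
theorem IsSevenPath.adj_outside (h : IsSevenPath G a b c d e f g) (hG : ¬ HasTwoP4 G.Adj)
    (hw : w ∉ [a, b, c, d, e, f, g]) {x : V} (hx : G.Adj w x) :
    x = b ∨ x = d ∨ x = f ∨ x ∉ [a, b, c, d, e, f, g] := by
  have h1 := h.not_adj_outside hG hw
  have h2 := h.reverse.not_adj_outside (w := w) hG (by simp at hw ⊢; tauto)
  simp
  grind

/-- Otherwise `w' w b a` and `c d e f` form `2P₄`. -/
theorem IsSevenPath.not_adj_second (h : IsSevenPath G a b c d e f g) (hG : ¬ HasTwoP4 G.Adj)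
    (hw : w ∉ [a, b, c, d, e, f, g]) (hw' : w' ∉ [a, b, c, d, e, f, g]) (hww : G.Adj w w') :
    ¬ G.Adj w b := by
  have hne := hww.ne
  obtain ⟨hnd, hab, hbc, hcd, hde, hef, hfg⟩ := h
  simp at hnd hw hw'
  refine fun h => hG ⟨w', w, b, a, c, d, e, f, ?_, hww.symm, h, hab.symm, hcd, hde, hef⟩
  simp
  grind

/-- A neighbour of a vertex outside a path on seven vertices that has a neighbour outside. -/
theorem IsSevenPath.adj_outside_of_adj (h : IsSevenPath G a b c d e f g)
    (hG : ¬ HasTwoP4 G.Adj) (hw : w ∉ [a, b, c, d, e, f, g]) (hw' : w' ∉ [a, b, c, d, e, f, g])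
    (hww : G.Adj w w') {x : V} (hx : G.Adj w x) : x = d ∨ x ∉ [a, b, c, d, e, f, g] := by
  have h1 := h.not_adj_second hG hw hw' hww
  have h2 := h.reverse.not_adj_second (w := w) (w' := w') hG (by simp at hw ⊢; tauto)
    (by simp at hw' ⊢; tauto) hww
  have h3 := h.adj_outside hG hw hx
  grind

/-- The neighbourhood of a vertex outside a path on seven vertices that has a neighbour outside. -/
theorem IsSevenPath.exists_triangle [Fintype V] [DecidableRel G.Adj]
    (h : IsSevenPath G a b c d e f g) (hG : ¬ HasTwoP4 G.Adj) (hdeg : ∀ v, 3 ≤ G.degree v)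
    (hw : w ∉ [a, b, c, d, e, f, g]) (hw' : w' ∉ [a, b, c, d, e, f, g]) (hww : G.Adj w w') :
    ∃ w'' ∉ [a, b, c, d, e, f, g], w'' ≠ w ∧ w'' ≠ w' ∧ G.Adj w w'' ∧ G.Adj w' w'' ∧
      ∀ x, G.Adj w x → x = d ∨ x = w' ∨ x = w'' := by
  classical
  have out : ∀ {v v'}, v ∉ [a, b, c, d, e, f, g] → v' ∉ [a, b, c, d, e, f, g] → G.Adj v v' →
      ∃ v'' ∉ [a, b, c, d, e, f, g], v'' ≠ v' ∧ G.Adj v v'' := by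
    intro v v' hv hv' hvv
    obtain ⟨u, hu, hvu⟩ := exists_adj_notMem (G := G) (v := v) {d, v'}
      ((Finset.card_le_two.trans_lt (by simp : 2 < 3)).trans_le (hdeg v))
    simp only [Finset.mem_insert, Finset.mem_singleton, not_or] at hu
    exact ⟨u, (h.adj_outside_of_adj hG hv hv' hvv hvu).resolve_left hu.1, hu.2, hvu⟩
  have noP4 : ∀ {p q r s}, p ∉ [a, b, c, d, e, f, g] → q ∉ [a, b, c, d, e, f, g] →
      r ∉ [a, b, c, d, e, f, g] → s ∉ [a, b, c, d, e, f, g] → [p, q, r, s].Nodup →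
      G.Adj p q → G.Adj q r → G.Adj r s → False := by
    intro p q r s hp hq hr hs hnd hpq hqr hrs
    refine hG ⟨p, q, r, s, a, b, c, d, ?_, hpq, hqr, hrs, h.ab, h.bc, h.cd⟩
    have := h.nodup
    simp at hp hq hr hs hnd this ⊢
    grind
  have hne := hww.ne
  obtain ⟨w'', hw'', hne', hadj⟩ := out hw hw' hww
  obtain ⟨u, hu, huw, hadj'⟩ := out hw' hw hww.symm
  have hne'' := hadj.ne
  -- Two different further neighbours would give the path `u w' w w''`, disjoint from `a b c d`.
  obtain rfl : u = w'' := by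
    by_contra huw''
    have := hadj'.ne
    exact noP4 hu hw' hw hw'' (by simp; grind) hadj'.symm hww.symm hadj
  refine ⟨u, hu, huw, hne', hadj, hadj', fun x hx => ?_⟩
  rcases h.adj_outside_of_adj hG hw hw' hww hx with hxd | hxo
  · exact Or.inl hxd
  · by_contra! hc
    have := hx.ne
    exact noP4 hxo hw hw' hu (by simp; grind) hx.symm hww hadj'

/-- An edge between `{a, b, c}` and `{e, f, g}` would complete a path on four vertices that avoids
`d`. So the neighbours of `v` are among the other three of `a, b, c, d`. -/
theorem IsSevenPath.degree_le_of_mem_half [Fintype V] [DecidableRel G.Adj]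
    (h : IsSevenPath G a b c d e f g)
    (hno : ∀ p q r s, [p, q, r, s].Nodup → d ∉ [p, q, r, s] →
      (∀ x ∈ [p, q, r, s], x ∈ [a, b, c, d, e, f, g]) → G.Adj p q → G.Adj q r → G.Adj r s → False)
    (hout : ∀ x y, x ∈ [a, b, c] → G.Adj x y → y ∈ [a, b, c, d, e, f, g]) {v : V}
    (hv : v ∈ [a, b, c]) : G.degree v ≤ 3 := by
  classical
  obtain ⟨hnd, hab, hbc, hcd, hde, hef, hfg⟩ := h
  simp at hnd
  have key : ∀ x ∈ [a, b, c], ∀ y ∈ [e, f, g], ¬ G.Adj x y := by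
    intro x hx y hy hxy
    simp at hx hy
    rcases hx with rfl | rfl | rfl <;> rcases hy with rfl | rfl | rfl
    · exact hno c b x y (by simp; grind) (by simp; grind) (by simp) hbc.symm hab.symm hxy
    · exact hno c b x y (by simp; grind) (by simp; grind) (by simp) hbc.symm hab.symm hxy
    · exact hno c b x y (by simp; grind) (by simp; grind) (by simp) hbc.symm hab.symm hxy
    · exact hno a x y f (by simp; grind) (by simp; grind) (by simp) hab hxy hef
    · exact hno a x y g (by simp; grind) (by simp; grind) (by simp) hab hxy hfg
    · exact hno a x y f (by simp; grind) (by simp; grind) (by simp) hab hxy hfg.symm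
    · exact hno a b x y (by simp; grind) (by simp; grind) (by simp) hab hbc hxy
    · exact hno a b x y (by simp; grind) (by simp; grind) (by simp) hab hbc hxy
    · exact hno a b x y (by simp; grind) (by simp; grind) (by simp) hab hbc hxy
  refine (degree_le_of_forall_adj_mem (({a, b, c, d} : Finset V).erase v) fun u hu => ?_).trans ?_
  · have h1 := hout v u hv hu
    have h2 := fun hu' => key v hv u hu' hu
    have h3 := hu.ne'
    simp at h1 h2 ⊢
    grind
  · rw [Finset.card_erase_of_mem (by simp at hv ⊢; grind)]
    have := Finset.card_le_four (a := a) (b := b) (c := c) (d := d)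
    omega

/-- If two vertices outside a path on seven vertices are adjacent, then all vertices but the middle
one of the path have degree at most three. -/
theorem IsSevenPath.degree_le [Fintype V] [DecidableRel G.Adj]
    (h : IsSevenPath G a b c d e f g) (hG : ¬ HasTwoP4 G.Adj) (hdeg : ∀ v, 3 ≤ G.degree v)
    (hw : w ∉ [a, b, c, d, e, f, g]) (hw' : w' ∉ [a, b, c, d, e, f, g]) (hww : G.Adj w w') {v : V}
    (hv : v ≠ d) : G.degree v ≤ 3 := by
  classical
  obtain ⟨w'', hw'', hne, hne', hadj, hadj', hnbr⟩ := h.exists_triangle hG hdeg hw hw' hww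
  -- Degree at least three forces `w` to be joined to all of `d, w', w''`. Then `w' w'' w d` is a
  -- path, so no path on four vertices avoids all of `d, w, w', w''`.
  have hwd : G.Adj w d := subset_neighborFinset_of_degree {d, w', w''}
    (Finset.card_le_three.trans (hdeg w)) (by simpa using hnbr) (by simp)
  have hnww := hww.ne
  have hno : ∀ p q r s, [p, q, r, s].Nodup → d ∉ [p, q, r, s] →
      (∀ x ∈ [p, q, r, s], x ≠ w ∧ x ≠ w' ∧ x ≠ w'') →
      G.Adj p q → G.Adj q r → G.Adj r s → False := by
    intro p q r s hnd hd hx hpq hqr hrs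
    refine hG ⟨w', w'', w, d, p, q, r, s, ?_, hadj', hadj.symm, hwd, hpq, hqr, hrs⟩
    simp at hnd hd hx hw hw' hw'' ⊢
    grind
  have hno' : ∀ p q r s, [p, q, r, s].Nodup → d ∉ [p, q, r, s] →
      (∀ x ∈ [p, q, r, s], x ∈ [a, b, c, d, e, f, g]) →
      G.Adj p q → G.Adj q r → G.Adj r s → False := fun p q r s hnd hd hx =>
    hno p q r s hnd hd fun x hx' =>
      ⟨fun hh => hw (hh ▸ hx x hx'), fun hh => hw' (hh ▸ hx x hx'), fun hh => hw'' (hh ▸ hx x hx')⟩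
  -- An outside vertex `z` with no outside neighbour would be joined to `b`, `d` and `f`, and `a b z
  -- f` would be a forbidden path.
  have hout : ∀ z ∉ [a, b, c, d, e, f, g], ∃ z' ∉ [a, b, c, d, e, f, g], G.Adj z z' := by
    intro z hz
    by_contra! hc
    have hnb : ∀ u, G.Adj z u → u ∈ ({b, d, f} : Finset V) := fun u hu => by
      have h1 := h.adj_outside hG hz hu
      have h2 := fun hu' => hc u hu' hu
      simp only [Finset.mem_insert, Finset.mem_singleton]
      tauto
    have hzb : G.Adj z b :=
      subset_neighborFinset_of_degree _ (Finset.card_le_three.trans (hdeg z)) hnb (by simp)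
    have hzf : G.Adj z f :=
      subset_neighborFinset_of_degree _ (Finset.card_le_three.trans (hdeg z)) hnb (by simp)
    have hzw : z ≠ w := fun h => hc w' hw' (h ▸ hww)
    have hzw' : z ≠ w' := fun h => hc w hw (h ▸ hww.symm)
    have hzw'' : z ≠ w'' := fun h => hc w hw (h ▸ hadj.symm)
    have hnd := h.nodup
    refine hno a b z f ?_ ?_ ?_ h.ab hzb.symm hzf
    all_goals
      simp at hnd hz hw hw' hw'' ⊢
      grind
  -- Every outside vertex has an outside neighbour, so `d` is its only possible neighbour on the
  -- path.
  have hcl : ∀ x y, x ∈ [a, b, c, e, f, g] → G.Adj x y → y ∈ [a, b, c, d, e, f, g] := by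
    intro x y hx hxy
    by_contra hy
    obtain ⟨z, hz, hyz⟩ := hout y hy
    have h1 := h.adj_outside_of_adj hG hy hz hyz hxy.symm
    have h2 := h.nodup
    simp at h1 h2 hx
    grind
  by_cases hvp : v ∈ [a, b, c, d, e, f, g]
  · by_cases hv3 : v ∈ [a, b, c]
    · exact h.degree_le_of_mem_half hno' (fun x y hx => hcl x y (by simp at hx ⊢; tauto)) hv3
    · refine h.reverse.degree_le_of_mem_half (fun p q r s hnd hd hx =>
        hno' p q r s hnd hd fun x hx' => ?_) (fun x y hx hxy => ?_) (by simp at hvp hv3 ⊢; tauto)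
      · have := hx x hx'
        simp at this ⊢
        tauto
      · have := hcl x y (by simp at hx ⊢; tauto) hxy
        simp at this ⊢
        tauto
  · obtain ⟨z, hz, hvz⟩ := hout v hvp
    obtain ⟨z', -, -, -, -, -, hz'⟩ := h.exists_triangle hG hdeg hvp hz hvz
    exact (degree_le_of_forall_adj_mem {d, z, z'} (by simpa using hz')).trans Finset.card_le_three

/-- In a graph with many edges, a vertex outside a path on seven vertices is adjacent exactly to
the second, the fourth and the sixth vertex of the path. -/
theorem IsSevenPath.adj_outside_iff [Fintype V] [DecidableRel G.Adj]
    (h : IsSevenPath G a b c d e f g) (hG : ¬ HasTwoP4 G.Adj) (hdeg : ∀ v, 3 ≤ G.degree v)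
    (hE : 2 * Fintype.card V ≤ G.edgeFinset.card + 1) (hw : w ∉ [a, b, c, d, e, f, g]) (x : V) :
    G.Adj w x ↔ x = b ∨ x = d ∨ x = f := by
  classical
  have hind : ∀ w' ∉ [a, b, c, d, e, f, g], ¬ G.Adj w w' := by
    intro w' hw' hww
    have h1 := G.sum_degrees_eq_twice_card_edges
    -- The degree of `d` is at most `n - 1 = 3 + (n - 4)` and all others are at most three, so there
    -- are at most `2n - 2` edges, against the `2n - 1` of `hE`.
    have h2 : ∑ v, G.degree v ≤ ∑ v, (3 + if v = d then Fintype.card V - 4 else 0) := by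
      refine Finset.sum_le_sum fun v _ => ?_
      split_ifs with hv
      · have := G.degree_lt_card_verts v
        omega
      · exact h.degree_le hG hdeg hw hw' hww hv
    rw [Finset.sum_add_distrib, Finset.sum_ite_eq' Finset.univ d] at h2
    simp only [Finset.sum_const, Finset.card_univ, smul_eq_mul, Finset.mem_univ, if_true] at h2
    have := G.degree_lt_card_verts d
    have := hdeg d
    omega
  have hnb : ∀ u, G.Adj w u → u ∈ ({b, d, f} : Finset V) := fun u hu => by
    have h1 := h.adj_outside hG hw hu
    have h2 := fun hu' => hind u hu' hu
    simp only [Finset.mem_insert, Finset.mem_singleton]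
    tauto
  exact ⟨fun hx => by simpa using hnb x hx, fun hx => subset_neighborFinset_of_degree _
    (Finset.card_le_three.trans (hdeg w)) hnb (by simpa using hx)⟩

end

/-! ### Robustness from ten vertices on -/

section

variable {V W : Type*} {G : SimpleGraph V}

theorem isRobust_of_three_le_degree [Fintype V] [DecidableRel G.Adj]
    (hdeg : ∀ v, 3 ≤ G.degree v) (hV : 10 ≤ Fintype.card V)
    (hE : 2 * Fintype.card V ≤ G.edgeFinset.card + 1) : IsRobust G := by
  classical
  by_contra hr
  have hG : ¬ HasTwoP4 G.Adj := fun h => hr (Or.inl h)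
  obtain ⟨l, hl, hnd, hch⟩ := hasPath_seven hdeg (by omega) hG
  obtain ⟨a, b, c, d, e, f, g, rfl⟩ : ∃ a b c d e f g, l = [a, b, c, d, e, f, g] :=
    match l, hl with
    | [a, b, c, d, e, f, g], _ => ⟨a, b, c, d, e, f, g, rfl⟩
  have h : IsSevenPath G a b c d e f g := by
    simp only [List.isChain_cons_cons] at hch
    exact ⟨hnd, hch.1, hch.2.1, hch.2.2.1, hch.2.2.2.1, hch.2.2.2.2.1, hch.2.2.2.2.2.1⟩
  obtain ⟨w₁, w₂, w₃, hw₁, hw₂, hw₃, hw₁₂, hw₁₃, hw₂₃⟩ : ∃ w₁ w₂ w₃,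
      w₁ ∉ [a, b, c, d, e, f, g] ∧ w₂ ∉ [a, b, c, d, e, f, g] ∧ w₃ ∉ [a, b, c, d, e, f, g] ∧
      w₁ ≠ w₂ ∧ w₁ ≠ w₃ ∧ w₂ ≠ w₃ := by
    have hcard : 2 < ([a, b, c, d, e, f, g].toFinset)ᶜ.card := by
      rw [Finset.card_compl, List.toFinset_card_of_nodup hnd]
      simp only [List.length_cons, List.length_nil]
      omega
    obtain ⟨w₁, h₁, w₂, h₂, w₃, h₃, h⟩ := Finset.two_lt_card.1 hcard
    simp only [Finset.mem_compl, List.mem_toFinset] at h₁ h₂ h₃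
    exact ⟨w₁, w₂, w₃, h₁, h₂, h₃, h⟩
  have hw := h.adj_outside_iff hG hdeg hE hw₁
  have hwb : G.Adj w₁ b := (hw b).2 (by simp)
  have hwd : G.Adj w₁ d := (hw d).2 (by simp)
  have hwf : G.Adj w₁ f := (hw f).2 (by simp)
  -- Put `w₁` in the place of `a`: the result is again a path on seven vertices, now with `a`
  -- outside. The same exchange works for `c`, `e` and `g`.
  have ha : ∀ x, G.Adj a x ↔ x = b ∨ x = d ∨ x = f := by
    have h' : IsSevenPath G w₁ b c d e f g :=
      ⟨by simp at hnd hw₁ ⊢; grind, hwb, h.bc, h.cd, h.de, h.ef, h.fg⟩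
    exact h'.adj_outside_iff hG hdeg hE (by simp at hnd hw₁ ⊢; grind)
  have hc : ∀ x, G.Adj c x ↔ x = b ∨ x = d ∨ x = f := by
    have h' : IsSevenPath G a b w₁ d e f g :=
      ⟨by simp at hnd hw₁ ⊢; grind, h.ab, hwb.symm, hwd, h.de, h.ef, h.fg⟩
    exact h'.adj_outside_iff hG hdeg hE (by simp at hnd hw₁ ⊢; grind)
  have he : ∀ x, G.Adj e x ↔ x = b ∨ x = d ∨ x = f := by
    have h' : IsSevenPath G a b c d w₁ f g :=
      ⟨by simp at hnd hw₁ ⊢; grind, h.ab, h.bc, h.cd, hwd.symm, hwf, h.fg⟩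
    exact h'.adj_outside_iff hG hdeg hE (by simp at hnd hw₁ ⊢; grind)
  have hg : ∀ x, G.Adj g x ↔ x = b ∨ x = d ∨ x = f := by
    have h' : IsSevenPath G a b c d e f w₁ :=
      ⟨by simp at hnd hw₁ ⊢; grind, h.ab, h.bc, h.cd, h.de, h.ef, hwf.symm⟩
    exact h'.adj_outside_iff hG hdeg hE (by simp at hnd hw₁ ⊢; grind)
  have hw₂' := h.adj_outside_iff hG hdeg hE hw₂
  have hw₃' := h.adj_outside_iff hG hdeg hE hw₃
  have hac : ¬ G.Adj a c := by
    rw [ha]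
    simp at hnd
    grind
  refine hr (Or.inr ⟨a, c, by rintro rfl; simp at hnd, hac, fun u v huv => ?_⟩)
  have hne : s(a, c) ≠ s(u, v) := fun h => by
    rw [← mem_edgeSet, ← h, mem_edgeSet] at huv
    exact hac huv
  -- The list consists of the edges other than `ac` of the copy `e b a c`, `g d w₁ f`. The copy `w₂
  -- d a c`, `w₃ f g b` shares only `ac` with it, so at least one of the two avoids `uv`.
  by_cases hT : s(u, v) ∈ [s(e, b), s(b, a), s(g, d), s(d, w₁), s(w₁, f)]
  · refine ⟨w₂, d, a, c, w₃, f, g, b, ?_, ?_⟩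
    · simp at hnd hw₂ hw₃ ⊢
      grind
    · have key : ∀ x y, G.Adj x y → s(x, y) ∉ [s(e, b), s(b, a), s(g, d), s(d, w₁), s(w₁, f)] →
          (G.Adj x y ∨ s(x, y) = s(a, c)) ∧ s(x, y) ≠ s(u, v) :=
        fun x y hxy hmem => ⟨Or.inl hxy, fun h => hmem (h ▸ hT)⟩
      refine ⟨key _ _ ((hw₂' d).2 (by simp)) ?_, key _ _ ((ha d).2 (by simp)).symm ?_,
        ⟨Or.inr rfl, hne⟩, key _ _ ((hw₃' f).2 (by simp)) ?_, key _ _ ((hg f).2 (by simp)).symm ?_,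
        key _ _ ((hg b).2 (by simp)) ?_⟩ <;>
      · simp at hnd hw₁ hw₂ hw₃ ⊢
        grind
  · refine ⟨e, b, a, c, g, d, w₁, f, ?_, ?_⟩
    · simp at hnd hw₁ ⊢
      grind
    · have key : ∀ x y, G.Adj x y → s(x, y) ∈ [s(e, b), s(b, a), s(g, d), s(d, w₁), s(w₁, f)] →
          (G.Adj x y ∨ s(x, y) = s(a, c)) ∧ s(x, y) ≠ s(u, v) :=
        fun x y hxy hmem => ⟨Or.inl hxy, fun h => hT (h ▸ hmem)⟩
      exact ⟨key _ _ ((he b).2 (by simp)) (by simp), key _ _ h.ab.symm (by simp),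
        ⟨Or.inr rfl, hne⟩, key _ _ ((hg d).2 (by simp)) (by simp), key _ _ hwd.symm (by simp),
        key _ _ hwf (by simp)⟩

theorem HasTwoP4.map {R : V → V → Prop} {S : W → W → Prop} (φ : V ↪ W)
    (hφ : ∀ a b, R a b → S (φ a) (φ b)) (h : HasTwoP4 R) : HasTwoP4 S := by
  obtain ⟨a, b, c, d, e, f, g, h, hnd, h1, h2, h3, h4, h5, h6⟩ := h
  exact ⟨φ a, φ b, φ c, φ d, φ e, φ f, φ g, φ h, hnd.map φ.injective, hφ _ _ h1, hφ _ _ h2,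
    hφ _ _ h3, hφ _ _ h4, hφ _ _ h5, hφ _ _ h6⟩

theorem IsRobust.of_comap {H : SimpleGraph W} (φ : V ↪ W) (h : IsRobust (H.comap φ))
    (hne : ∃ a b, (H.comap φ).Adj a b) : IsRobust H := by
  rcases h with h | ⟨u, v, huv, hadj, h⟩
  · exact Or.inl (h.map φ fun _ _ h => h)
  refine Or.inr ⟨φ u, φ v, φ.injective.ne huv, hadj, fun a b hab => ?_⟩
  have aux : ∀ x y, s(x, y) = s(u, v) → s(φ x, φ y) = s(φ u, φ v) := fun x y h => by
    simpa using congrArg (Sym2.map φ) h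
  by_cases hs : ∃ p q, s(φ p, φ q) = s(a, b)
  · obtain ⟨p, q, hs⟩ := hs
    have hpq : (H.comap φ).Adj p q := by
      rw [← mem_edgeSet, ← hs, mem_edgeSet] at hab
      exact hab
    refine (h p q hpq).map φ fun x y hxy => ⟨hxy.1.imp id (aux x y), fun h' => hxy.2 ?_⟩
    rw [← hs] at h'
    exact Sym2.map.injective φ.injective (by simpa using h')
  -- If the deleted edge lies outside the subgraph, any copy found inside avoids it. Deleting an
  -- arbitrary edge `pq` of the subgraph supplies one.
  · obtain ⟨p, q, hpq⟩ := hne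
    exact (h p q hpq).map φ fun x y hxy => ⟨hxy.1.imp id (aux x y), fun h' => hs ⟨x, y, h'⟩⟩

end

/-- A graph on `n ≥ 8` vertices with more than `max (2n - 2) 16` edges is robust. -/
theorem isRobust_of_card_edgeFinset (n : ℕ) (hn : 8 ≤ n) {V : Type*} [Fintype V]
    (G : SimpleGraph V) [DecidableRel G.Adj] (hV : Fintype.card V = n)
    (hE : max (2 * n - 2) 16 < G.edgeFinset.card) : IsRobust G := by
  classical
  induction n, hn using Nat.le_induction generalizing V with
  | base => exact isRobust_of_card_eight_or_nine (Or.inl hV) (by omega)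
  | succ n hn ih =>
    -- The bound is 16 for both eight and nine vertices, so deleting a vertex would lose too much
    -- here. From ten vertices on it is `2n - 2`.
    rcases hn.eq_or_lt with rfl | hn
    · exact isRobust_of_card_eight_or_nine (Or.inr hV) (by omega)
    by_cases hdeg : ∀ v, 3 ≤ G.degree v
    · exact isRobust_of_three_le_degree hdeg (by omega) (by omega)
    push Not at hdeg
    obtain ⟨v, hv⟩ := hdeg
    have hcard : (G.induce {v}ᶜ).edgeFinset.card = G.edgeFinset.card - G.degree v := by
      rw [card_edgeFinset_induce_compl_singleton, card_edgeFinset_deleteIncidenceSet]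
    refine IsRobust.of_comap (Function.Embedding.subtype (· ∈ ({v}ᶜ : Set V)))
      (ih (G.induce {v}ᶜ) ?_ (by omega)) ?_
    · rw [Fintype.card_compl_set, Set.card_singleton]
      omega
    · obtain ⟨e, he⟩ := Finset.card_pos.1 (show 0 < (G.induce {v}ᶜ).edgeFinset.card by omega)
      induction e with | _ a b
      exact ⟨a, b, by simpa using he⟩

/-! ### From robust graphs to rainbow copies -/

theorem HasTwoP4.hasRainbowCopy {V K : Type*} {R : V → V → Prop} {c : TopEdgeLabeling V K}
    (h : HasTwoP4 R) (hR : ∀ x y, R x y → x ≠ y)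
    (hc : ∀ e e' : (⊤ : SimpleGraph V).edgeSet, (∀ x y, s(x, y) = e.1 → R x y) →
      (∀ x y, s(x, y) = e'.1 → R x y) → c e = c e' → e = e')
    (hsymm : ∀ x y, R x y → R y x) : HasRainbowCopy twoP4 c := by
  obtain ⟨x₀, x₁, x₂, x₃, y₀, y₁, y₂, y₃, hnd, h₁, h₂, h₃, h₄, h₅, h₆⟩ := h
  have hpath : ∀ {z : Fin 4 → V}, R (z 0) (z 1) → R (z 1) (z 2) → R (z 2) (z 3) →
      ∀ i j, (pathGraph 4).Adj i j → R (z i) (z j) := by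
    intro z h1 h2 h3 i j hij
    rw [pathGraph_adj] at hij
    have h1' := hsymm _ _ h1
    have h2' := hsymm _ _ h2
    have h3' := hsymm _ _ h3
    fin_cases i <;> fin_cases j <;> first | assumption | simp at hij
  have hadj : ∀ i j, twoP4.Adj i j →
      R (Sum.elim ![x₀, x₁, x₂, x₃] ![y₀, y₁, y₂, y₃] i)
        (Sum.elim ![x₀, x₁, x₂, x₃] ![y₀, y₁, y₂, y₃] j) := by
    rintro (i | i) (j | j) hij
    · exact hpath (z := ![x₀, x₁, x₂, x₃]) h₁ h₂ h₃ i j hij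
    · exact absurd hij (by simp [twoP4])
    · exact absurd hij (by simp [twoP4])
    · exact hpath (z := ![y₀, y₁, y₂, y₃]) h₄ h₅ h₆ i j hij
  have hinj : Function.Injective (Sum.elim ![x₀, x₁, x₂, x₃] ![y₀, y₁, y₂, y₃]) := by
    simp at hnd
    refine Function.Injective.sumElim ?_ ?_ ?_
    · intro i j hij
      fin_cases i <;> fin_cases j <;> simp at hij ⊢ <;> grind
    · intro i j hij
      fin_cases i <;> fin_cases j <;> simp at hij ⊢ <;> grind
    · intro i j hij
      fin_cases i <;> fin_cases j <;> simp at hij <;> grind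
  let F : Copy twoP4 (⊤ : SimpleGraph V) :=
    ⟨⟨Sum.elim ![x₀, x₁, x₂, x₃] ![y₀, y₁, y₂, y₃], fun {i j} hij => hR _ _ (hadj i j hij)⟩, hinj⟩
  refine ⟨F, ?_⟩
  have hmem : ∀ e : twoP4.edgeSet, ∀ x y, s(x, y) = (F.mapEdgeSet e).1 → R x y := by
    rintro ⟨e, he⟩ x y hxy
    induction e with | _ i j
    have hxy' : s(x, y) = s(F i, F j) := hxy
    rcases Sym2.eq_iff.1 hxy' with ⟨rfl, rfl⟩ | ⟨rfl, rfl⟩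
    · exact hadj i j he
    · exact hadj j i (Adj.symm he)
  intro e e' hee
  exact F.mapEdgeSet.injective (hc _ _ (hmem e) (hmem e') hee)

/-- A colouring of a complete graph whose colours are represented by the edges of a robust graph
has a rainbow `2P₄`. -/
theorem hasRainbowCopy_of_isRobust {V K : Type*} {c : TopEdgeLabeling V K}
    (r : K → (⊤ : SimpleGraph V).edgeSet) (hr : ∀ i, c (r i) = i)
    (h : IsRobust (fromEdgeSet (Set.range fun i => (r i).1))) : HasRainbowCopy twoP4 c := by
  have hrep : ∀ e : (⊤ : SimpleGraph V).edgeSet,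
      e.1 ∈ (fromEdgeSet (Set.range fun i => (r i).1)).edgeSet → e = r (c e) := by
    rintro e he
    rw [edgeSet_fromEdgeSet] at he
    obtain ⟨⟨i, hi⟩, -⟩ := he
    obtain rfl : r i = e := Subtype.ext hi
    rw [hr]
  rcases h with h | ⟨u, v, huv, hadj, h⟩
  · refine h.hasRainbowCopy (fun x y hxy => hxy.ne) (fun e e' he he' hee => ?_)
      fun _ _ h => h.symm
    have key : ∀ e : (⊤ : SimpleGraph V).edgeSet, (∀ x y, s(x, y) = e.1 →
        (fromEdgeSet (Set.range fun i => (r i).1)).Adj x y) → e = r (c e) := by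
      rintro ⟨e, he⟩ h
      induction e with | _ x y
      exact hrep _ ((mem_edgeSet _).2 (h x y rfl))
    rw [key e he, key e' he', hee]
  let f : (⊤ : SimpleGraph V).edgeSet := ⟨s(u, v), huv⟩
  -- The edge `ab` is the representative of the colour of `uv`; once it is deleted, `uv` can take
  -- its place.
  have hab : ∃ a b, s(a, b) = (r (c f)).1 ∧
      (fromEdgeSet (Set.range fun i => (r i).1)).Adj a b := by
    rcases hrc : r (c f) with ⟨g, hg⟩
    induction g with | _ a b
    exact ⟨a, b, rfl, (fromEdgeSet_adj _).2 ⟨⟨c f, congrArg Subtype.val hrc⟩, hg⟩⟩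
  obtain ⟨a, b, hab, hadj'⟩ := hab
  refine (h a b hadj').hasRainbowCopy (fun x y hxy => ?_) (fun e e' he he' hee => ?_)
    fun x y hxy => by rwa [Sym2.eq_swap, adj_comm]
  · rcases hxy.1 with hxy | hxy
    · exact hxy.ne
    · rintro rfl
      rcases Sym2.eq_iff.1 hxy with ⟨rfl, hv⟩ | ⟨rfl, hu⟩
      · exact huv hv
      · exact huv hu.symm
  · have key : ∀ e : (⊤ : SimpleGraph V).edgeSet, (∀ x y, s(x, y) = e.1 →
        ((fromEdgeSet (Set.range fun i => (r i).1)).Adj x y ∨ s(x, y) = s(u, v)) ∧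
          s(x, y) ≠ s(a, b)) → (e = r (c e) ∨ e = f) ∧ e ≠ r (c f) := by
      rintro ⟨e, he⟩ h
      induction e with | _ x y
      obtain ⟨h1, h2⟩ := h x y rfl
      refine ⟨h1.imp (fun h => hrep _ ((mem_edgeSet _).2 h)) fun h => Subtype.ext h,
        fun h => h2 ?_⟩
      rw [hab, ← h]
    obtain ⟨h1, h2⟩ := key e he
    obtain ⟨h1', h2'⟩ := key e' he'
    rcases h1 with h1 | rfl <;> rcases h1' with h1' | rfl
    · rw [h1, h1', hee]
    · exact absurd (hee ▸ h1) h2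
    · exact absurd (hee ▸ h1') h2'
    · rfl

theorem le_of_mem_colorCounts {n k : ℕ} (hn : 8 ≤ n) (hk : k ∈ colorCounts n twoP4) :
    k ≤ max (2 * n - 2) 16 := by
  classical
  obtain ⟨c, hc, hno⟩ := hk
  by_contra! hlt
  choose r hr using hc
  obtain ⟨G, hG⟩ : ∃ G, G = fromEdgeSet (Set.range fun i => (r i).1) := ⟨_, rfl⟩
  refine hno (hasRainbowCopy_of_isRobust r hr (hG ▸
    isRobust_of_card_edgeFinset n hn G (Fintype.card_fin n) (hlt.trans_le ?_)))
  have hinj : Function.Injective fun i => (r i).1 := fun i j hij => by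
    rw [← hr i, ← hr j, Subtype.ext hij]
  calc k = (Finset.univ.image fun i => (r i).1).card := by
        rw [Finset.card_image_of_injective _ hinj, Finset.card_univ, Fintype.card_fin]
    _ ≤ _ := Finset.card_le_card fun e he => by
        obtain ⟨i, -, rfl⟩ := Finset.mem_image.1 he
        rw [mem_edgeFinset, hG, edgeSet_fromEdgeSet]
        exact ⟨⟨i, rfl⟩, not_isDiag_of_mem_edgeSet _ (r i).2⟩

/-! ### The two extremal colourings -/

/-- A colouring in which each copy of `2P₄` has two edges of the colour `k`. -/
theorem mem_colorCounts_of_colouring {n k : ℕ} (φ : ℕ → ℕ → ℕ) (hφ : ∀ i j, φ i j ≤ k)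
    (hsurj : ∀ m ≤ k, ∃ i j, i < j ∧ j < n ∧ φ i j = m)
    (hcopy : ∀ x : Fin 4 ⊕ Fin 4 → Fin n, Function.Injective x → ∃ p q p' q',
      twoP4.Adj p q ∧ twoP4.Adj p' q' ∧ s(p, q) ≠ s(p', q') ∧
      φ (min (x p) (x q)) (max (x p) (x q)) = k ∧ φ (min (x p') (x q')) (max (x p') (x q')) = k) :
    k + 1 ∈ colorCounts n twoP4 := by
  refine ⟨fun e => ⟨φ (e.1.map Fin.val).inf (e.1.map Fin.val).sup, Nat.lt_succ_of_le (hφ _ _)⟩,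
    ?_, ?_⟩
  · rintro ⟨m, hm⟩
    obtain ⟨i, j, hij, hj, rfl⟩ := hsurj m (Nat.le_of_lt_succ hm)
    refine ⟨⟨s(⟨i, hij.trans hj⟩, ⟨j, hj⟩), ?_⟩, ?_⟩
    · simp [hij.ne]
    · refine Fin.ext ?_
      simp [hij.le]
  · rintro ⟨f, hf⟩
    obtain ⟨p, q, p', q', h, h', hne, hk, hk'⟩ := hcopy f f.injective
    refine hne (congrArg Subtype.val (@hf ⟨s(p, q), h⟩ ⟨s(p', q'), h'⟩ (Fin.ext ?_)))
    exact hk.trans hk'.symm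

instance : DecidableRel twoP4.Adj
  | .inl i, .inl j => decidable_of_iff (i.val + 1 = j.val ∨ j.val + 1 = i.val) (by
      simp [twoP4, pathGraph_adj])
  | .inr i, .inr j => decidable_of_iff (i.val + 1 = j.val ∨ j.val + 1 = i.val) (by
      simp [twoP4, pathGraph_adj])
  | .inl _, .inr _ => isFalse (by simp [twoP4])
  | .inr _, .inl _ => isFalse (by simp [twoP4])

/-- Any two vertices of `2P₄` meet at least two of its edges. -/
theorem exists_two_edges_meeting : ∀ x y : Fin 4 ⊕ Fin 4, x ≠ y →
    ∃ p q, (p = x ∨ p = y) ∧ twoP4.Adj p q ∧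
      ∃ p' q', (p' = x ∨ p' = y) ∧ twoP4.Adj p' q' ∧ s(p, q) ≠ s(p', q') := by
  decide +kernel

/-- Any two vertices of `2P₄` miss at least two of its edges. -/
theorem exists_two_edges_missing : ∀ x y : Fin 4 ⊕ Fin 4,
    ∃ p q, ¬ (p = x ∨ p = y ∨ q = x ∨ q = y) ∧ twoP4.Adj p q ∧
      ∃ p' q', ¬ (p' = x ∨ p' = y ∨ q' = x ∨ q' = y) ∧ twoP4.Adj p' q' ∧
        s(p, q) ≠ s(p', q') := by
  decide +kernel

theorem sixteen_mem_colorCounts {n : ℕ} (hn : 8 ≤ n) : 16 ∈ colorCounts n twoP4 := by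
  refine mem_colorCounts_of_colouring (k := 15)
    -- The pairs `i < j < 6` are numbered from 0 to 14 by `j(j - 1)/2 + i`; all other edges get
    -- colour 15.
    (fun i j => if i < j ∧ j < 6 then j * (j - 1) / 2 + i else 15) (fun i j => ?_) ?_
    fun x hx => ?_
  · split_ifs with h
    · obtain ⟨h1, h2⟩ := h
      interval_cases j <;> omega
    · exact le_rfl
  · have key : ∀ m < 15, ∃ j < 6, ∃ i < j, j * (j - 1) / 2 + i = m := by decide
    intro m hm
    rcases hm.eq_or_lt with rfl | hm
    · exact ⟨6, 7, by omega, by omega, by simp⟩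
    · obtain ⟨j, hj, i, hi, rfl⟩ := key m hm
      exact ⟨i, j, hi, by omega, by simp [hi, hj]⟩
  · obtain ⟨u, v, huv, hu, hv⟩ : ∃ u v, u ≠ v ∧ 6 ≤ (x u).val ∧ 6 ≤ (x v).val := by
      have h1 : 1 < (Finset.univ.filter fun u => 6 ≤ (x u).val).card := by
        have h2 := Finset.card_filter_add_card_filter_not (s := Finset.univ)
          (fun u => 6 ≤ (x u).val)
        have h3 : (Finset.univ.filter fun u => ¬ 6 ≤ (x u).val).card ≤ (Finset.range 6).card :=
          Finset.card_le_card_of_injOn (fun u => (x u).val) (fun u hu => by simpa using hu)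
            fun u _ v _ h => hx (Fin.ext h)
        simp at h2 h3
        omega
      obtain ⟨u, hu, v, hv, huv⟩ := Finset.one_lt_card.1 h1
      simp at hu hv
      exact ⟨u, v, huv, hu, hv⟩
    obtain ⟨p, q, hp, hpq, p', q', hp', hpq', hne⟩ := exists_two_edges_meeting u v huv
    have key : ∀ p q, p = u ∨ p = v → ¬ max (x p).val (x q).val < 6 := by
      rintro p q (rfl | rfl) <;> omega
    refine ⟨p, q, p', q', hpq, hpq', hne, ?_, ?_⟩
    · exact if_neg fun h => key p q hp h.2
    · exact if_neg fun h => key p' q' hp' h.2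

theorem two_mul_sub_mem_colorCounts {n : ℕ} (hn : 8 ≤ n) : 2 * n - 2 ∈ colorCounts n twoP4 := by
  have := mem_colorCounts_of_colouring (n := n) (k := 2 * n - 3)
    -- The edges at vertex 0 get the colours `0, …, n - 2`, the remaining edges at vertex 1 get `n -
    -- 1, …, 2n - 4`, and all others get `2n - 3`.
    (fun i j => if i < 2 ∧ i < j ∧ j < n then i * (n - 2) + (j - 1) else 2 * n - 3)
    (fun i j => ?_) ?_ fun x hx => ?_
  · rwa [show 2 * n - 3 + 1 = 2 * n - 2 by omega] at this
  · split_ifs with h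
    · obtain ⟨h1, h2, h3⟩ := h
      interval_cases i <;> omega
    · exact le_rfl
  · intro m hm
    rcases hm.eq_or_lt with rfl | hm
    · exact ⟨2, 3, by omega, by omega, by simp⟩
    rcases lt_or_ge m (n - 1) with h | h
    · exact ⟨0, m + 1, by omega, by omega, by rw [if_pos (by omega)]; omega⟩
    · exact ⟨1, m + 3 - n, by omega, by omega, by rw [if_pos (by omega)]; omega⟩
  -- A copy need not use both special vertices. Missing positions are filled arbitrarily, so `u` and
  -- `v` may coincide, which `exists_two_edges_missing` permits.
  · obtain ⟨u, v, huv⟩ : ∃ u v, ∀ w, (x w).val < 2 → w = u ∨ w = v := by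
      by_cases h0 : ∃ u, (x u).val = 0 <;> by_cases h1 : ∃ v, (x v).val = 1
      · obtain ⟨u, hu⟩ := h0
        obtain ⟨v, hv⟩ := h1
        refine ⟨u, v, fun w hw => ?_⟩
        rcases Nat.le_one_iff_eq_zero_or_eq_one.1 (Nat.le_of_lt_succ hw) with h | h
        · exact Or.inl (hx (Fin.ext (h.trans hu.symm)))
        · exact Or.inr (hx (Fin.ext (h.trans hv.symm)))
      · obtain ⟨u, hu⟩ := h0
        refine ⟨u, u, fun w hw => Or.inl (hx (Fin.ext ?_))⟩
        have : (x w).val ≠ 1 := fun h => h1 ⟨w, h⟩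
        omega
      · obtain ⟨v, hv⟩ := h1
        refine ⟨v, v, fun w hw => Or.inl (hx (Fin.ext ?_))⟩
        have : (x w).val ≠ 0 := fun h => h0 ⟨w, h⟩
        omega
      · refine ⟨.inl 0, .inl 0, fun w hw => ?_⟩
        have h2 : (x w).val ≠ 0 := fun h => h0 ⟨w, h⟩
        have h3 : (x w).val ≠ 1 := fun h => h1 ⟨w, h⟩
        omega
    obtain ⟨p, q, hp, hpq, p', q', hp', hpq', hne⟩ := exists_two_edges_missing u v
    have key : ∀ p q, ¬ (p = u ∨ p = v ∨ q = u ∨ q = v) → ¬ min (x p).val (x q).val < 2 := by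
      intro p q hpq hlt
      rcases min_lt_iff.1 hlt with h | h
      · exact hpq ((huv p h).imp_right Or.inl)
      · exact hpq (Or.inr (Or.inr (huv q h)))
    refine ⟨p, q, p', q', hpq, hpq', hne, ?_, ?_⟩
    · exact if_neg fun h => key p q hp h.1
    · exact if_neg fun h => key p' q' hp' h.1

end AntiRamsey

theorem theorem10 (n : ℕ) (hn : 8 ≤ n) :
    AntiRamsey.antiRamseyNumber n AntiRamsey.twoP4 = max (2 * n - 2) 16 := by
  refine (IsGreatest.csSup_eq ⟨?_, fun k hk => AntiRamsey.le_of_mem_colorCounts hn hk⟩)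
  rcases le_total (2 * n - 2) 16 with h | h
  · rw [max_eq_right h]
    exact AntiRamsey.sixteen_mem_colorCounts hn
  · rw [max_eq_left h]
    exact AntiRamsey.two_mul_sub_mem_colorCounts hn
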